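/- Let $\Omega\subset\mathbb R^2$ be open and let $f:\Omega\to\mathbb R^3$ be a $C^\infty$ regular parametrized surface (that is, $f_u,f_v$ are linearly independent at every point) whose coordinate lines are curvature lines, i.e. the directions $\partial_u$ and $\partial_v$ are principal directions (eigenvectors of the second fundamental form relative to the first) at every point of $\Omega$. Let $(u_0,v_0)\in\Omega$ be a non-umbilic point, i.e. the second fundamental form there is not a multiple of the first. For $\varepsilon>0$ put $$A=f(u_0,v_0),\quad B=f(u_0+\varepsilon,v_0),\quad C=f(u_0,v_0+\varepsilon),\quad D=f(u_0+\varepsilon,v_0+\varepsilon).$$ Then there are a neighborhood $U_0\subset\Omega$ of $(u_0,v_0)$ and a constant $K$ such that for every neighborhood $U\subset U_0$ of $(u_0,v_0)$ there is $\varepsilon_0>0$ such that for all $0<\varepsilon<\varepsilon_0$: the square $[u_0,u_0+\varepsilon]\times[v_0,v_0+\varepsilon]$ lies in $U$; the points $A,B,C$ are not collinear; and the circle $\omega_{ABC}$ through $A,B,C$ meets the surface patch $f(U)$ in exactly one further point $M\notin\{A,B,C\}$ (so $\omega_{ABC}\cap f(U)=\{A,B,C,M\}$), which satisfies $$d(D,M)\le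 K\varepsilon^3 .$$ -/

import Mathlib

open scoped ContDiff Topology

noncomputable section

/-- Euclidean three-space. -/
abbrev E3 : Type := EuclideanSpace ℝ (Fin 3)

/-- The vector product in Euclidean three-space. -/
def cross3 (x y : E3) : E3 := WithLp.toLp 2 (crossProduct x.ofLp y.ofLp)

/-- The partial derivative `f_u` at `p = (u, v)`. -/
def partialU (f : ℝ × ℝ → E3) (p : ℝ × ℝ) : E3 := fderiv ℝ f p (1, 0)

/-- The partial derivative `f_v` at `p = (u, v)`. -/
def partialV (f : ℝ × ℝ → E3) (p : ℝ × ℝ) : E3 := fderiv ℝ f p (0, 1)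

/-- The unit normal `(f_u × f_v) / |f_u × f_v|` of a parametrized surface. -/
def unitNormal (f : ℝ × ℝ → E3) (p : ℝ × ℝ) : E3 :=
  ‖cross3 (partialU f p) (partialV f p)‖⁻¹ • cross3 (partialU f p) (partialV f p)

/-- The first fundamental form `I_p(w, x) = ⟨df_p w, df_p x⟩`. -/
def firstForm (f : ℝ × ℝ → E3) (p w x : ℝ × ℝ) : ℝ :=
  inner ℝ (fderiv ℝ f p w) (fderiv ℝ f p x)

/-- The second fundamental form `II_p(w, x) = ⟨n(p), d²f_p(w, x)⟩`. -/
def secondForm (f : ℝ × ℝ → E3) (p w x : ℝ × ℝ) : ℝ :=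
  inner ℝ (unitNormal f p) (fderiv ℝ (fun q => fderiv ℝ f q) p w x)

/-- `w` is a principal direction at `p`: a nonzero eigenvector of the second fundamental form
relative to the first, the eigenvalue being the corresponding principal curvature. -/
def IsPrincipalDirection (f : ℝ × ℝ → E3) (p w : ℝ × ℝ) : Prop :=
  w ≠ 0 ∧ ∃ κ : ℝ, ∀ x : ℝ × ℝ, secondForm f p w x = κ * firstForm f p w x

/-- `p` is umbilic: the second fundamental form is a multiple of the first, that is, the two
principal curvatures coincide. -/
def IsUmbilic (f : ℝ × ℝ → E3) (p : ℝ × ℝ) : Prop :=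
  ∃ κ : ℝ, ∀ w x : ℝ × ℝ, secondForm f p w x = κ * firstForm f p w x

/-- `f : Ω → ℝ³` is a smooth regular parametrized surface both of whose families of coordinate
lines are curvature lines (their tangents are principal directions everywhere). -/
structure IsCurvatureLineNet (f : ℝ × ℝ → E3) (Ω : Set (ℝ × ℝ)) : Prop where
  isOpen : IsOpen Ω
  smooth : ContDiffOn ℝ ∞ f Ω
  regular : ∀ p ∈ Ω, LinearIndependent ℝ ![partialU f p, partialV f p]
  principal_u : ∀ p ∈ Ω, IsPrincipalDirection f p (1, 0)
  principal_v : ∀ p ∈ Ω, IsPrincipalDirection f p (0, 1)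

/-- The circle through three non-collinear points: the points of the plane of `A`, `B`, `C` that
have the same distance as `A`, `B`, `C` to a centre in that plane. -/
def circleThrough (A B C : E3) : Set E3 :=
  {X | X ∈ affineSpan ℝ ({A, B, C} : Set E3) ∧
    ∃ O ∈ affineSpan ℝ ({A, B, C} : Set E3),
      dist A O = dist X O ∧ dist B O = dist X O ∧ dist C O = dist X O}

end

open scoped ContDiff Topology
open Asymptotics Filter

/-! Magnify the surface by 1/ε around A and use the parameter q = (x, y) for the point f(p + εq), so
that A, B, C, D sit at the corners of the unit square. The circle ABC is the common zero set of a
plane equation (`det3`) and a sphere equation (`circleForm`). Let E, G be the squared norms of f_u,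
f_v, and let L, N be the values of det(·, f_u, f_v) at f_uu, f_vv. At a non-umbilic point the
principal directions are orthogonal and det(f_uv, f_u, f_v) = 0. Hence, as ε tends to 0, the plane
equation divided by ε and the sphere equation become, up to nonzero factors, L(x² - x) + N(y² - y) =
0 and E(x² - x) + G(y² - y) = 0. Non-umbilicity says LG ≠ NE, so the limit system is x² = x, y² = y,
with four simple solutions.

On a fixed ball the true system differs from its limit by ε times uniformly bounded and uniformly
Lipschitz functions (`FirstOrder`), so it too has exactly four solutions there
(`eventually_four_zeros`). Three are the parameters of A, B, C. At (1, 1) both equations have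
residual O(ε²): the terms of order 0 and 1 in ε (`Jet`) are multiples of ⟨f_u, f_v⟩, det(f_uv, f_u,
f_v) and their derivatives along (1, 1), apart from the order-0 term of the circle equation, which
vanishes because a rectangle is cyclic. These derivatives vanish because non-umbilicity is an open
condition, so that the relations hold near p (`IsCurvatureLineNet.jet`). The fourth solution is
therefore O(ε²) away from (1, 1), which is O(ε³) on the surface.

No other point of f(U) lies on the circle: the magnified circles have bounded size
(`eventually_circle_bounded`) and f is bilipschitz near p (`exists_bilipschitz_nhds`), so all
candidate parameters q lie in one fixed ball. -/

/-! ### Equations of the circle through three points. -/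

/-- The determinant of three vectors of Euclidean three-space. -/
noncomputable def det3 (x y z : E3) : ℝ := inner ℝ x (cross3 y z)

lemma E3.inner_eq (x y : E3) : inner ℝ x y = x 0 * y 0 + x 1 * y 1 + x 2 * y 2 := by
  simp [PiLp.inner_apply, Fin.sum_univ_three, mul_comm]

lemma det3_eq (x y z : E3) : det3 x y z =
    x 0 * (y 1 * z 2 - y 2 * z 1) + x 1 * (y 2 * z 0 - y 0 * z 2)
      + x 2 * (y 0 * z 1 - y 1 * z 0) := by
  simp [det3, E3.inner_eq, cross3, cross_apply]

/-- The Gram determinant of two vectors. -/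
noncomputable def gram2 (b c : E3) : ℝ := inner ℝ b b * inner ℝ c c - inner ℝ b c ^ 2

/-- A polynomial which, together with `det3 x b c`, cuts out the circle through `0`, `b`, `c`. -/
noncomputable def circleForm (x b c : E3) : ℝ :=
  gram2 b c * inner ℝ x x - inner ℝ b b * inner ℝ c c * (inner ℝ x b + inner ℝ x c)
    + inner ℝ b c * (inner ℝ b b * inner ℝ x c + inner ℝ c c * inner ℝ x b)

lemma E3.ext_coord {x y : E3} (h0 : x 0 = y 0) (h1 : x 1 = y 1) (h2 : x 2 = y 2) : x = y := by
  ext i; fin_cases i <;> assumption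

/-- Cramer's rule in the frame b, c, b × c: once the determinant vanishes, x is a combination of b
and c. -/
lemma gram2_smul_eq (x b c : E3) : gram2 b c • x =
    (inner ℝ x b * inner ℝ c c - inner ℝ x c * inner ℝ b c) • b
      + (inner ℝ x c * inner ℝ b b - inner ℝ x b * inner ℝ b c) • c
      + det3 x b c • cross3 b c := by
  apply E3.ext_coord <;>
  · simp only [gram2, det3_eq, E3.inner_eq]
    simp [cross3, cross_apply]
    ring

lemma det3_add_smul (s t : ℝ) (b c : E3) : det3 (s • b + t • c) b c = 0 := by
  simp [det3_eq]; ring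

lemma circleForm_add_smul (s t : ℝ) (b c : E3) : circleForm (s • b + t • c) b c =
    gram2 b c * (inner ℝ (s • b + t • c) (s • b + t • c) - s * inner ℝ b b - t * inner ℝ c c) := by
  simp only [circleForm, gram2, inner_add_left, inner_add_right, real_inner_smul_left,
    real_inner_smul_right, real_inner_comm b c]
  ring

lemma mem_affineSpan_triple {A B C X : E3} : X ∈ affineSpan ℝ ({A, B, C} : Set E3) ↔
    ∃ s t : ℝ, X - A = s • (B - A) + t • (C - A) := by
  rw [← AffineSubspace.vsub_right_mem_direction_iff_mem
    (subset_affineSpan ℝ _ (Set.mem_insert A _) : A ∈ affineSpan ℝ ({A, B, C} : Set E3)),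
    direction_affineSpan, vectorSpan_eq_span_vsub_set_right ℝ (Set.mem_insert A _)]
  simp only [Set.image_insert_eq, Set.image_singleton, vsub_eq_sub, sub_self,
    Submodule.span_insert_zero, Submodule.mem_span_pair, eq_comm]

lemma dist_eq_dist_iff_inner {A X O : E3} :
    dist A O = dist X O ↔ inner ℝ (X - A) (X - A) = 2 * inner ℝ (X - A) (O - A) := by
  have h : X - O = (X - A) - (O - A) := by abel
  rw [dist_eq_norm, dist_eq_norm, ← sq_eq_sq₀ (norm_nonneg _) (norm_nonneg _), h,
    norm_sub_sq_real (X - A), norm_sub_rev A O, real_inner_self_eq_norm_sq]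
  constructor <;> intro h <;> linarith

/-- The determinant gives the plane. If O is the circumcentre relative to A, `circleForm` is `gram2`
times |x|² - 2⟨x, O⟩, a sphere through A, B, C centred in that plane. -/
lemma mem_circleThrough_iff {A B C X : E3} (h : gram2 (B - A) (C - A) ≠ 0) :
    X ∈ circleThrough A B C ↔
      det3 (X - A) (B - A) (C - A) = 0 ∧ circleForm (X - A) (B - A) (C - A) = 0 := by
  -- Comparing every distance with that of A makes each condition linear in the centre.
  have key : ∀ O : E3, (dist A O = dist X O ∧ dist B O = dist X O ∧ dist C O = dist X O) ↔
      (dist A O = dist X O ∧ dist A O = dist B O ∧ dist A O = dist C O) := by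
    intro O
    constructor
    · rintro ⟨h1, h2, h3⟩; exact ⟨h1, h1.trans h2.symm, h1.trans h3.symm⟩
    · rintro ⟨h1, h2, h3⟩; exact ⟨h1, h2.symm.trans h1, h3.symm.trans h1⟩
  simp only [circleThrough, Set.mem_ofPred_eq, key]
  simp only [dist_eq_dist_iff_inner, mem_affineSpan_triple]
  set b := B - A
  set c := C - A
  constructor
  · rintro ⟨⟨s, t, hx⟩, O, -, h1, h2, h3⟩
    rw [hx] at h1 ⊢
    refine ⟨det3_add_smul s t b c, ?_⟩
    rw [circleForm_add_smul, h1, inner_add_left, real_inner_smul_left, real_inner_smul_left]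
    linear_combination (-gram2 b c) * (s * h2 + t * h3)
  · rintro ⟨h1, h2⟩
    have hx := gram2_smul_eq (X - A) b c
    rw [h1, zero_smul, add_zero] at hx
    obtain ⟨s, t, hst⟩ : ∃ s t : ℝ, X - A = s • b + t • c := by
      have hx' := congrArg ((gram2 b c)⁻¹ • ·) hx
      simp only [inv_smul_smul₀ h, smul_add, smul_smul] at hx'
      exact ⟨_, _, hx'⟩
    rw [hst] at h2 ⊢
    rw [circleForm_add_smul] at h2
    have h2' := (mul_eq_zero.1 h2).resolve_left h
    -- Coordinates of the circumcentre, solving 2⟨b, O⟩ = |b|² and 2⟨c, O⟩ = |c|².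
    let σ : ℝ := inner ℝ c c * (inner ℝ b b - inner ℝ b c) / (2 * gram2 b c)
    let τ : ℝ := inner ℝ b b * (inner ℝ c c - inner ℝ b c) / (2 * gram2 b c)
    have hb : inner ℝ b b = 2 * inner ℝ b (σ • b + τ • c) := by
      simp only [inner_add_right, real_inner_smul_right, σ, τ]
      field_simp
      simp only [gram2]; ring
    have hc : inner ℝ c c = 2 * inner ℝ c (σ • b + τ • c) := by
      simp only [inner_add_right, real_inner_smul_right, σ, τ, real_inner_comm b c]
      field_simp
      simp only [gram2]; ring
    refine ⟨⟨s, t, rfl⟩, A + (σ • b + τ • c), ⟨σ, τ, by abel⟩, ?_⟩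
    rw [add_sub_cancel_left]
    refine ⟨?_, hb, hc⟩
    rw [inner_add_left _ _ (σ • b + τ • c), real_inner_smul_left, real_inner_smul_left]
    linear_combination h2' + s * hb + t * hc

lemma affineIndependent_of_gram2_ne_zero {A B C : E3} (h : gram2 (B - A) (C - A) ≠ 0) :
    AffineIndependent ℝ ![A, B, C] := by
  rw [affineIndependent_iff_not_collinear_set, collinear_iff_of_mem (Set.mem_insert A _)]
  rintro ⟨v, hv⟩
  obtain ⟨r, hr⟩ := hv B (by simp)
  obtain ⟨r', hr'⟩ := hv C (by simp)
  apply h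
  simp only [hr, hr', vadd_eq_add, add_sub_cancel_right, gram2, real_inner_smul_left,
    real_inner_smul_right]
  ring

/-! ### Calculus of expansions in ε: uniform in q, and at a fixed q to first order. -/

lemma tendsto_param_zero : Tendsto (fun ε : ℝ => ε) (𝓝[>] 0) (𝓝 0) :=
  tendsto_id.mono_left nhdsWithin_le_nhds

lemma isBigO_param_one : (fun ε : ℝ => ε) =O[𝓝[>] 0] (fun _ => (1 : ℝ)) :=
  tendsto_param_zero.isBigO_one ℝ

/-- The functions `g ε`, for small `ε > 0`, are uniformly bounded and uniformly Lipschitz on the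
ball of radius `ρ`. -/
def UniformBddLip (ρ : ℝ) (g : ℝ → ℝ × ℝ → ℝ) : Prop :=
  ∃ K : ℝ, ∀ᶠ ε in 𝓝[>] (0 : ℝ), ∀ q, ‖q‖ ≤ ρ →
    |g ε q| ≤ K ∧ ∀ q', ‖q'‖ ≤ ρ → |g ε q - g ε q'| ≤ K * ‖q - q'‖

namespace UniformBddLip

variable {ρ : ℝ} {g h : ℝ → ℝ × ℝ → ℝ}

lemma const (c : ℝ) : UniformBddLip ρ (fun _ _ => c) :=
  ⟨|c|, Eventually.of_forall fun _ _ _ => ⟨le_rfl, fun _ _ => by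
    rw [sub_self, abs_zero]; positivity⟩⟩

lemma param : UniformBddLip ρ (fun ε _ => ε) := by
  refine ⟨1, ?_⟩
  filter_upwards [Ioo_mem_nhdsGT (zero_lt_one' ℝ)] with ε hε q _
  refine ⟨by rw [abs_of_pos hε.1]; exact hε.2.le, fun q' _ => ?_⟩
  simp

lemma fst : UniformBddLip ρ (fun _ q => q.1) := by
  refine ⟨max ρ 1, Eventually.of_forall fun _ q hq => ⟨?_, fun q' _ => ?_⟩⟩
  · exact ((norm_fst_le q).trans hq).trans (le_max_left _ _)
  · have := norm_fst_le (q - q')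
    exact this.trans (le_mul_of_one_le_left (norm_nonneg _) (le_max_right _ _))

lemma snd : UniformBddLip ρ (fun _ q => q.2) := by
  refine ⟨max ρ 1, Eventually.of_forall fun _ q hq => ⟨?_, fun q' _ => ?_⟩⟩
  · exact ((norm_snd_le q).trans hq).trans (le_max_left _ _)
  · have := norm_snd_le (q - q')
    exact this.trans (le_mul_of_one_le_left (norm_nonneg _) (le_max_right _ _))

lemma add (hg : UniformBddLip ρ g) (hh : UniformBddLip ρ h) :
    UniformBddLip ρ (fun ε q => g ε q + h ε q) := by
  obtain ⟨K, hK⟩ := hg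
  obtain ⟨K', hK'⟩ := hh
  refine ⟨K + K', ?_⟩
  filter_upwards [hK, hK'] with ε h1 h2 q hq
  refine ⟨(abs_add_le _ _).trans (add_le_add (h1 q hq).1 (h2 q hq).1), fun q' hq' => ?_⟩
  rw [add_sub_add_comm, add_mul]
  exact (abs_add_le _ _).trans (add_le_add ((h1 q hq).2 q' hq') ((h2 q hq).2 q' hq'))

lemma mul (hg : UniformBddLip ρ g) (hh : UniformBddLip ρ h) :
    UniformBddLip ρ (fun ε q => g ε q * h ε q) := by
  obtain ⟨K, hK⟩ := hg
  obtain ⟨K', hK'⟩ := hh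
  refine ⟨max (K * K') (2 * (K * K')), ?_⟩
  filter_upwards [hK, hK'] with ε h1 h2 q hq
  have a1 := (h1 q hq).1
  have a2 := (h2 q hq).1
  have p1 : 0 ≤ K := (abs_nonneg _).trans a1
  have p2 : 0 ≤ K' := (abs_nonneg _).trans a2
  refine ⟨?_, fun q' hq' => ?_⟩
  · rw [abs_mul]
    exact (mul_le_mul a1 a2 (abs_nonneg _) p1).trans (le_max_left _ _)
  · have b1 := (h1 q hq).2 q' hq'
    have b2 := (h2 q hq).2 q' hq'
    have e : g ε q * h ε q - g ε q' * h ε q' =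
      g ε q * (h ε q - h ε q') + (g ε q - g ε q') * h ε q' := by ring
    rw [e]
    refine (abs_add_le _ _).trans ?_
    rw [abs_mul, abs_mul]
    have c1 := mul_le_mul a1 b2 (abs_nonneg _) p1
    have c2 := mul_le_mul b1 (h2 q' hq').1 (abs_nonneg _) (by positivity)
    calc _ ≤ (2 * (K * K')) * ‖q - q'‖ := by linarith
      _ ≤ _ := mul_le_mul_of_nonneg_right (le_max_right _ _) (norm_nonneg _)

lemma neg (hg : UniformBddLip ρ g) : UniformBddLip ρ (fun ε q => -g ε q) := by
  simpa using (const (-1)).mul hg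

lemma sub (hg : UniformBddLip ρ g) (hh : UniformBddLip ρ h) :
    UniformBddLip ρ (fun ε q => g ε q - h ε q) := by
  simpa [sub_eq_add_neg] using hg.add hh.neg

lemma eval (hg : UniformBddLip ρ g) {q₀ : ℝ × ℝ} (hq₀ : ‖q₀‖ ≤ ρ) :
    UniformBddLip ρ (fun ε _ => g ε q₀) := by
  obtain ⟨K, hK⟩ := hg
  refine ⟨K, ?_⟩
  filter_upwards [hK] with ε h1 q _
  refine ⟨(h1 q₀ hq₀).1, fun q' _ => ?_⟩
  have : 0 ≤ K := (abs_nonneg _).trans (h1 q₀ hq₀).1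
  rw [sub_self, abs_zero]; positivity

lemma isBigO_one (hg : UniformBddLip ρ g) {q₀ : ℝ × ℝ} (hq₀ : ‖q₀‖ ≤ ρ) :
    (fun ε => g ε q₀) =O[𝓝[>] 0] (fun _ => (1 : ℝ)) := by
  obtain ⟨K, hK⟩ := hg
  refine IsBigO.of_bound K ?_
  filter_upwards [hK] with ε h1
  simpa using (h1 q₀ hq₀).1

end UniformBddLip

/-- `g ε = g₀ + ε g₁ ε` on the ball of radius `ρ`, where `g₀` and the `g₁ ε` are uniformly bounded
and uniformly Lipschitz. -/
def FirstOrder (ρ : ℝ) (g : ℝ → ℝ × ℝ → ℝ) (g₀ : ℝ × ℝ → ℝ) : Prop :=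
  UniformBddLip ρ (fun _ => g₀) ∧ ∃ g₁, UniformBddLip ρ g₁ ∧
    ∀ᶠ ε in 𝓝[>] (0 : ℝ), ∀ q, ‖q‖ ≤ ρ → g ε q = g₀ q + ε * g₁ ε q

namespace FirstOrder

variable {ρ : ℝ} {g h : ℝ → ℝ × ℝ → ℝ} {g₀ h₀ : ℝ × ℝ → ℝ}

lemma const (c : ℝ) : FirstOrder ρ (fun _ _ => c) (fun _ => c) :=
  ⟨.const c, fun _ _ => 0, .const 0, Eventually.of_forall fun _ _ _ => by simp⟩

lemma add (hg : FirstOrder ρ g g₀) (hh : FirstOrder ρ h h₀) :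
    FirstOrder ρ (fun ε q => g ε q + h ε q) (fun q => g₀ q + h₀ q) := by
  obtain ⟨b, g₁, b₁, e⟩ := hg
  obtain ⟨b', h₁, b₁', e'⟩ := hh
  refine ⟨b.add b', _, b₁.add b₁', ?_⟩
  filter_upwards [e, e'] with ε h1 h2 q hq
  rw [h1 q hq, h2 q hq]; ring

lemma sub (hg : FirstOrder ρ g g₀) (hh : FirstOrder ρ h h₀) :
    FirstOrder ρ (fun ε q => g ε q - h ε q) (fun q => g₀ q - h₀ q) := by
  obtain ⟨b, g₁, b₁, e⟩ := hg
  obtain ⟨b', h₁, b₁', e'⟩ := hh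
  refine ⟨b.sub b', _, b₁.sub b₁', ?_⟩
  filter_upwards [e, e'] with ε h1 h2 q hq
  rw [h1 q hq, h2 q hq]; ring

lemma mul (hg : FirstOrder ρ g g₀) (hh : FirstOrder ρ h h₀) :
    FirstOrder ρ (fun ε q => g ε q * h ε q) (fun q => g₀ q * h₀ q) := by
  obtain ⟨b, g₁, b₁, e⟩ := hg
  obtain ⟨b', h₁, b₁', e'⟩ := hh
  refine ⟨b.mul b', _, ((b.mul b₁').add (b₁.mul b')).add
    (UniformBddLip.param.mul (b₁.mul b₁')), ?_⟩
  filter_upwards [e, e'] with ε h1 h2 q hq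
  rw [h1 q hq, h2 q hq]; ring

lemma eval (hg : FirstOrder ρ g g₀) {q₀ : ℝ × ℝ} (hq₀ : ‖q₀‖ ≤ ρ) :
    FirstOrder ρ (fun ε _ => g ε q₀) (fun _ => g₀ q₀) := by
  obtain ⟨b, g₁, b₁, e⟩ := hg
  refine ⟨b.eval hq₀, _, b₁.eval hq₀, ?_⟩
  filter_upwards [e] with ε h1 q _
  exact h1 q₀ hq₀

lemma congr (hg : FirstOrder ρ g g₀) (h0 : ∀ q, g₀ q = h₀ q)
    (h1 : ∀ᶠ ε in 𝓝[>] (0 : ℝ), ∀ q, g ε q = h ε q) : FirstOrder ρ h h₀ := by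
  obtain rfl : g₀ = h₀ := funext h0
  obtain ⟨b, g₁, b₁, e⟩ := hg
  refine ⟨b, g₁, b₁, ?_⟩
  filter_upwards [h1, e] with ε h1 h2 q hq
  rw [← h1, h2 q hq]

lemma tendsto (hg : FirstOrder ρ g g₀) {q₀ : ℝ × ℝ} (hq₀ : ‖q₀‖ ≤ ρ) :
    Tendsto (fun ε => g ε q₀) (𝓝[>] 0) (𝓝 (g₀ q₀)) := by
  obtain ⟨b, g₁, b₁, e⟩ := hg
  have h1 : Tendsto (fun ε : ℝ => ε * g₁ ε q₀) (𝓝[>] 0) (𝓝 0) := by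
    have h2 : (fun ε : ℝ => ε * g₁ ε q₀) =O[𝓝[>] 0] (fun ε : ℝ => ε * 1) :=
      (isBigO_refl _ _).mul (b₁.isBigO_one hq₀)
    refine h2.trans_tendsto ?_
    simpa using tendsto_param_zero
  have h2 := (tendsto_const_nhds (x := g₀ q₀)).add h1
  rw [add_zero] at h2
  refine h2.congr' ?_
  filter_upwards [e] with ε h
  exact (h q₀ hq₀).symm

end FirstOrder

/-- Coordinatewise `FirstOrder` for maps into Euclidean space. -/
def FirstOrderE3 (ρ : ℝ) (X : ℝ → ℝ × ℝ → E3) (X₀ : ℝ × ℝ → E3) : Prop :=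
  ∀ i, FirstOrder ρ (fun ε q => X ε q i) (fun q => X₀ q i)

namespace FirstOrderE3

variable {ρ : ℝ} {X Y Z : ℝ → ℝ × ℝ → E3} {X₀ Y₀ Z₀ : ℝ × ℝ → E3}

lemma inner (hX : FirstOrderE3 ρ X X₀) (hY : FirstOrderE3 ρ Y Y₀) :
    FirstOrder ρ (fun ε q => inner ℝ (X ε q) (Y ε q)) (fun q => inner ℝ (X₀ q) (Y₀ q)) := by
  simp only [E3.inner_eq]
  exact (((hX 0).mul (hY 0)).add ((hX 1).mul (hY 1))).add ((hX 2).mul (hY 2))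

lemma det3 (hX : FirstOrderE3 ρ X X₀) (hY : FirstOrderE3 ρ Y Y₀) (hZ : FirstOrderE3 ρ Z Z₀) :
    FirstOrder ρ (fun ε q => det3 (X ε q) (Y ε q) (Z ε q))
      (fun q => _root_.det3 (X₀ q) (Y₀ q) (Z₀ q)) := by
  simp only [det3_eq]
  exact (((hX 0).mul (((hY 1).mul (hZ 2)).sub ((hY 2).mul (hZ 1)))).add
    ((hX 1).mul (((hY 2).mul (hZ 0)).sub ((hY 0).mul (hZ 2))))).add
    ((hX 2).mul (((hY 0).mul (hZ 1)).sub ((hY 1).mul (hZ 0))))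

lemma gram2 (hX : FirstOrderE3 ρ X X₀) (hY : FirstOrderE3 ρ Y Y₀) :
    FirstOrder ρ (fun ε q => gram2 (X ε q) (Y ε q)) (fun q => _root_.gram2 (X₀ q) (Y₀ q)) := by
  simp only [_root_.gram2, pow_two]
  exact ((hX.inner hX).mul (hY.inner hY)).sub ((hX.inner hY).mul (hX.inner hY))

lemma circleForm (hX : FirstOrderE3 ρ X X₀) (hY : FirstOrderE3 ρ Y Y₀)
    (hZ : FirstOrderE3 ρ Z Z₀) :
    FirstOrder ρ (fun ε q => circleForm (X ε q) (Y ε q) (Z ε q))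
      (fun q => _root_.circleForm (X₀ q) (Y₀ q) (Z₀ q)) := by
  simp only [_root_.circleForm]
  exact (((hY.gram2 hZ).mul (hX.inner hX)).sub (((hY.inner hY).mul (hZ.inner hZ)).mul
    ((hX.inner hY).add (hX.inner hZ)))).add ((hY.inner hZ).mul
      (((hY.inner hY).mul (hX.inner hZ)).add ((hZ.inner hZ).mul (hX.inner hY))))

lemma eval (hX : FirstOrderE3 ρ X X₀) {q₀ : ℝ × ℝ} (hq₀ : ‖q₀‖ ≤ ρ) :
    FirstOrderE3 ρ (fun ε _ => X ε q₀) (fun _ => X₀ q₀) := fun i => (hX i).eval hq₀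

end FirstOrderE3

/-- `g ε = g₀ + ε g₁ + O(ε²)` as `ε` tends to `0` from the right. -/
def Jet (g : ℝ → ℝ) (g₀ g₁ : ℝ) : Prop :=
  (fun ε => g ε - g₀ - ε * g₁) =O[𝓝[>] 0] (fun ε : ℝ => ε ^ 2)

namespace Jet

variable {g h : ℝ → ℝ} {g₀ g₁ h₀ h₁ : ℝ}

lemma add (hg : Jet g g₀ g₁) (hh : Jet h h₀ h₁) :
    Jet (fun ε => g ε + h ε) (g₀ + h₀) (g₁ + h₁) :=
  (IsBigO.add hg hh).congr_left fun ε => by ring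

lemma sub (hg : Jet g g₀ g₁) (hh : Jet h h₀ h₁) :
    Jet (fun ε => g ε - h ε) (g₀ - h₀) (g₁ - h₁) :=
  (IsBigO.sub hg hh).congr_left fun ε => by ring

lemma isBigO_one (hg : Jet g g₀ g₁) : g =O[𝓝[>] 0] (fun _ => (1 : ℝ)) := by
  have h1 : (fun ε : ℝ => ε ^ 2) =O[𝓝[>] 0] (fun _ => (1 : ℝ)) := by
    simpa using isBigO_param_one.pow 2
  have h2 : (fun ε : ℝ => ε * g₁) =O[𝓝[>] 0] (fun _ => (1 : ℝ)) := by
    simpa using isBigO_param_one.mul (isBigO_const_const g₁ (one_ne_zero (α := ℝ)) _)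
  have h3 : (fun _ : ℝ => g₀) =O[𝓝[>] 0] (fun _ => (1 : ℝ)) :=
    isBigO_const_const g₀ (one_ne_zero (α := ℝ)) _
  exact ((IsBigO.trans hg h1).add (h3.add h2)).congr_left fun ε => by ring

lemma mul (hg : Jet g g₀ g₁) (hh : Jet h h₀ h₁) :
    Jet (fun ε => g ε * h ε) (g₀ * h₀) (g₁ * h₀ + g₀ * h₁) := by
  have h1 := IsBigO.mul hg hh.isBigO_one
  have h2 : (fun ε => (g₀ + ε * g₁) * (h ε - h₀ - ε * h₁)) =O[𝓝[>] 0]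
      (fun ε : ℝ => 1 * ε ^ 2) := by
    refine IsBigO.mul ?_ hh
    have h3 : (fun ε : ℝ => ε * g₁) =O[𝓝[>] 0] (fun _ => (1 : ℝ)) := by
      simpa using isBigO_param_one.mul (isBigO_const_const g₁ (one_ne_zero (α := ℝ)) _)
    exact (isBigO_const_const g₀ (one_ne_zero (α := ℝ)) _).add h3
  have h3 : (fun ε : ℝ => (g₁ * h₁) * ε ^ 2) =O[𝓝[>] 0] (fun ε : ℝ => ε ^ 2) :=
    (isBigO_refl _ _).const_mul_left _
  simp only [mul_one, one_mul] at h1 h2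
  exact ((h1.add h2).add h3).congr_left fun ε => by ring

/-- Used to differentiate an identity that holds along a ray: its derivative is the coefficient g₁.
-/
lemma eq_zero (hg : Jet g g₀ g₁) (h0 : ∀ᶠ ε in 𝓝[>] (0 : ℝ), g ε = 0) : g₀ = 0 ∧ g₁ = 0 := by
  have h1 : (fun ε => g₀ + ε * g₁) =O[𝓝[>] 0] (fun ε : ℝ => ε ^ 2) := by
    refine (hg.neg_left).congr' ?_ EventuallyEq.rfl
    filter_upwards [h0] with ε h
    rw [h]; ring
  have t := tendsto_param_zero
  have t0 : g₀ = 0 := by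
    have a1 : Tendsto (fun ε : ℝ => g₀ + ε * g₁) (𝓝[>] 0) (𝓝 0) :=
      h1.trans_tendsto (by simpa using t.pow 2)
    have a2 : Tendsto (fun ε : ℝ => g₀ + ε * g₁) (𝓝[>] 0) (𝓝 (g₀ + 0 * g₁)) :=
      tendsto_const_nhds.add (t.mul_const _)
    simpa using tendsto_nhds_unique a2 a1
  refine ⟨t0, ?_⟩
  have h2 : (fun _ : ℝ => g₁) =O[𝓝[>] 0] (fun ε : ℝ => ε) := by
    refine ((isBigO_refl (fun ε : ℝ => ε⁻¹) (𝓝[>] 0)).mul h1).congr' ?_ ?_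
    · filter_upwards [self_mem_nhdsWithin] with ε hε
      have : ε ≠ 0 := ne_of_gt hε
      rw [t0]; field_simp; ring
    · filter_upwards [self_mem_nhdsWithin] with ε hε
      have : ε ≠ 0 := ne_of_gt hε
      field_simp
  exact tendsto_nhds_unique tendsto_const_nhds (h2.trans_tendsto t)

end Jet

/-- `X ε = X₀ + ε X₁ + O(ε²)` in Euclidean space, coordinatewise. -/
def JetE3 (X : ℝ → E3) (X₀ X₁ : E3) : Prop := ∀ i, Jet (fun ε => X ε i) (X₀ i) (X₁ i)

namespace JetE3

variable {X Y Z : ℝ → E3} {X₀ X₁ Y₀ Y₁ Z₀ Z₁ : E3}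

lemma of_isBigO (h : (fun ε => X ε - X₀ - ε • X₁) =O[𝓝[>] 0] (fun ε : ℝ => ε ^ 2)) :
    JetE3 X X₀ X₁ := fun i =>
  (IsBigO.of_bound 1 (Eventually.of_forall fun ε => by
    simpa using PiLp.norm_apply_le (X ε - X₀ - ε • X₁) i)).trans h

lemma inner (hX : JetE3 X X₀ X₁) (hY : JetE3 Y Y₀ Y₁) :
    Jet (fun ε => inner ℝ (X ε) (Y ε)) (inner ℝ X₀ Y₀) (inner ℝ X₁ Y₀ + inner ℝ X₀ Y₁) := by
  simp only [E3.inner_eq]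
  convert (((hX 0).mul (hY 0)).add ((hX 1).mul (hY 1))).add ((hX 2).mul (hY 2)) using 1
  ring

lemma det3 (hX : JetE3 X X₀ X₁) (hY : JetE3 Y Y₀ Y₁) (hZ : JetE3 Z Z₀ Z₁) :
    Jet (fun ε => det3 (X ε) (Y ε) (Z ε)) (_root_.det3 X₀ Y₀ Z₀)
      (_root_.det3 X₁ Y₀ Z₀ + _root_.det3 X₀ Y₁ Z₀ + _root_.det3 X₀ Y₀ Z₁) := by
  simp only [det3_eq]
  convert (((hX 0).mul (((hY 1).mul (hZ 2)).sub ((hY 2).mul (hZ 1)))).add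
    ((hX 1).mul (((hY 2).mul (hZ 0)).sub ((hY 0).mul (hZ 2))))).add
    ((hX 2).mul (((hY 0).mul (hZ 1)).sub ((hY 1).mul (hZ 0)))) using 1
  ring

end JetE3

/-! ### Lipschitz perturbations of the system x² = x, y² = y. -/

lemma near_zero_or_one {x e : ℝ} (he : |e| ≤ 1 / 16) (h : x ^ 2 - x + e = 0) :
    x ≤ 1 / 4 ∧ -(1 / 4) ≤ x ∨ 3 / 4 ≤ x ∧ x ≤ 5 / 4 := by
  have := abs_le.1 he
  rcases le_or_gt x (1 / 2) with hx | hx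
  · left; constructor <;> nlinarith
  · right; constructor <;> nlinarith

lemma norm_prod_le_of_abs {q : ℝ × ℝ} {r : ℝ} (h1 : |q.1| ≤ r) (h2 : |q.2| ≤ r) : ‖q‖ ≤ r :=
  max_le h1 h2

/-- Subtracting the equations gives (x - y)(x + y - 1) on one side and a difference of perturbations
on the other. When the second factor is at least 1/2 in each coordinate, ‖q - q'‖ ≤ ‖q - q'‖/8. -/
lemma perturbed_zero_unique {e₁ e₂ : ℝ × ℝ → ℝ} {q q' : ℝ × ℝ}
    (b₁ : |e₁ q - e₁ q'| ≤ 1 / 16 * ‖q - q'‖) (b₂ : |e₂ q - e₂ q'| ≤ 1 / 16 * ‖q - q'‖)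
    (h₁ : q.1 ^ 2 - q.1 + e₁ q = 0) (h₂ : q.2 ^ 2 - q.2 + e₂ q = 0)
    (h₁' : q'.1 ^ 2 - q'.1 + e₁ q' = 0) (h₂' : q'.2 ^ 2 - q'.2 + e₂ q' = 0)
    (s₁ : 1 / 2 ≤ |q.1 + q'.1 - 1|) (s₂ : 1 / 2 ≤ |q.2 + q'.2 - 1|) : q = q' := by
  have key : ∀ {x y e e' n : ℝ}, |e - e'| ≤ 1 / 16 * n → x ^ 2 - x + e = 0 → y ^ 2 - y + e' = 0 →
      1 / 2 ≤ |x + y - 1| → |x - y| ≤ 1 / 8 * n := by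
    intro x y e e' n h hx hy hs
    have h1 : e - e' = -((x - y) * (x + y - 1)) := by linear_combination hx - hy
    rw [h1, abs_neg, abs_mul] at h
    nlinarith [abs_nonneg (x - y)]
  have h : ‖q - q'‖ ≤ 1 / 8 * ‖q - q'‖ :=
    norm_prod_le_of_abs (key b₁ h₁ h₁' s₁) (key b₂ h₂ h₂' s₂)
  have : ‖q - q'‖ = 0 := le_antisymm (by linarith) (norm_nonneg _)
  exact sub_eq_zero.1 (norm_eq_zero.1 this)

/-- The derivative of x² - x at 1 is 1, so near (1, 1) the system is close to a translate of the
identity and the quantitative inverse function theorem applies. -/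
lemma perturbed_zero_exists {ρ : ℝ} (hρ : 2 ≤ ρ) {e₁ e₂ : ℝ × ℝ → ℝ}
    (b₁ : ∀ q, ‖q‖ ≤ ρ → |e₁ q| ≤ 1 / 16 ∧ ∀ q', ‖q'‖ ≤ ρ → |e₁ q - e₁ q'| ≤ 1 / 16 * ‖q - q'‖)
    (b₂ : ∀ q, ‖q‖ ≤ ρ → |e₂ q| ≤ 1 / 16 ∧ ∀ q', ‖q'‖ ≤ ρ → |e₂ q - e₂ q'| ≤ 1 / 16 * ‖q - q'‖) :
    ∃ M : ℝ × ℝ, ‖M - (1, 1)‖ ≤ 4 * ‖(e₁ (1, 1), e₂ (1, 1))‖ ∧ ‖M - (1, 1)‖ ≤ 1 / 4 ∧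
      M.1 ^ 2 - M.1 + e₁ M = 0 ∧ M.2 ^ 2 - M.2 + e₂ M = 0 := by
  set r : ℝ := 4 * ‖(e₁ (1, 1), e₂ (1, 1))‖ with hr
  have n1 : ‖((1, 1) : ℝ × ℝ)‖ = 1 := by simp [Prod.norm_def]
  have r4 : r ≤ 1 / 4 := by
    have : ‖(e₁ (1, 1), e₂ (1, 1))‖ ≤ 1 / 16 :=
      norm_prod_le_of_abs (b₁ _ (by rw [n1]; linarith)).1 (b₂ _ (by rw [n1]; linarith)).1
    linarith
  have r0 : 0 ≤ r := by positivity
  have hball : ∀ q ∈ Metric.closedBall ((1, 1) : ℝ × ℝ) r,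
      ‖q‖ ≤ ρ ∧ |q.1 - 1| ≤ 1 / 4 ∧ |q.2 - 1| ≤ 1 / 4 := by
    intro q hq
    rw [mem_closedBall_iff_norm] at hq
    refine ⟨?_, (norm_fst_le (q - (1, 1))).trans (hq.trans r4),
      (norm_snd_le (q - (1, 1))).trans (hq.trans r4)⟩
    have := norm_le_norm_add_norm_sub' q (1, 1)
    rw [n1] at this
    linarith
  let Ψ : ℝ × ℝ → ℝ × ℝ := fun q => (q.1 ^ 2 - q.1 + e₁ q, q.2 ^ 2 - q.2 + e₂ q)
  -- The constant 9/16 is 1/2 from the quadratic part on a ball of radius at most 1/4, plus 1/16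
  -- from the perturbation.
  have happ : ApproximatesLinearOn Ψ (ContinuousLinearMap.id ℝ (ℝ × ℝ))
      (Metric.closedBall (1, 1) r) (9 / 16) := by
    intro q hq q' hq'
    obtain ⟨p1, p2, p3⟩ := hball q hq
    obtain ⟨p1', p2', p3'⟩ := hball q' hq'
    have key : ∀ {x y e e' n : ℝ}, |e - e'| ≤ 1 / 16 * n → |x - y| ≤ n → |x - 1| ≤ 1 / 4 →
        |y - 1| ≤ 1 / 4 → |(x ^ 2 - x + e) - (y ^ 2 - y + e') - (x - y)| ≤ 9 / 16 * n := by
      intro x y e e' n h hn hx hy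
      have e1 : (x ^ 2 - x + e) - (y ^ 2 - y + e') - (x - y) =
        (x - y) * ((x - 1) + (y - 1)) + (e - e') := by ring
      rw [e1]
      refine (abs_add_le _ _).trans ?_
      rw [abs_mul]
      have h2 : |(x - 1) + (y - 1)| ≤ 1 / 2 := (abs_add_le _ _).trans (by linarith)
      have := mul_le_mul hn h2 (abs_nonneg _) ((abs_nonneg _).trans hn)
      linarith
    have c : ((9 / 16 : NNReal) : ℝ) = 9 / 16 := by norm_num
    rw [c]
    exact norm_prod_le_of_abs
      (key ((b₁ q p1).2 q' p1') (norm_fst_le (q - q')) p2 p2')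
      (key ((b₂ q p1).2 q' p1') (norm_snd_le (q - q')) p3 p3')
  have hsurj := happ.surjOn_closedBall_of_nonlinearRightInverse
    ⟨id, 1, fun y => by simp, fun y => rfl⟩ r0 subset_rfl
  -- The image covers a ball of radius (1 - 9/16) · 4 = 7/4 times the residual at (1, 1), hence
  -- contains 0.
  have h0 : (0 : ℝ × ℝ) ∈ Metric.closedBall (Ψ (1, 1))
      ((((1 : NNReal) : ℝ)⁻¹ - ((9 / 16 : NNReal) : ℝ)) * r) := by
    rw [mem_closedBall_iff_norm, zero_sub, norm_neg]
    have : Ψ (1, 1) = (e₁ (1, 1), e₂ (1, 1)) := by simp [Ψ]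
    rw [this]
    have c : ((9 / 16 : NNReal) : ℝ) = 9 / 16 := by norm_num
    rw [c, NNReal.coe_one, hr]
    have := norm_nonneg (e₁ (1, 1), e₂ (1, 1))
    linarith
  obtain ⟨M, hM, hM0⟩ := hsurj h0
  rw [mem_closedBall_iff_norm] at hM
  exact ⟨M, hM, hM.trans r4, congrArg Prod.fst hM0, congrArg Prod.snd hM0⟩

/-- The corners of the unit square other than `(1, 1)`. -/
def threeCorners : Set (ℝ × ℝ) := {(0, 0), (1, 0), (0, 1)}

lemma perturbed_zeros {ρ : ℝ} (hρ : 2 ≤ ρ) {e₁ e₂ : ℝ × ℝ → ℝ}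
    (b₁ : ∀ q, ‖q‖ ≤ ρ → |e₁ q| ≤ 1 / 16 ∧ ∀ q', ‖q'‖ ≤ ρ → |e₁ q - e₁ q'| ≤ 1 / 16 * ‖q - q'‖)
    (b₂ : ∀ q, ‖q‖ ≤ ρ → |e₂ q| ≤ 1 / 16 ∧ ∀ q', ‖q'‖ ≤ ρ → |e₂ q - e₂ q'| ≤ 1 / 16 * ‖q - q'‖)
    (hz : ∀ q ∈ threeCorners, q.1 ^ 2 - q.1 + e₁ q = 0 ∧ q.2 ^ 2 - q.2 + e₂ q = 0) :
    ∃ M : ℝ × ℝ, ‖M - (1, 1)‖ ≤ 4 * ‖(e₁ (1, 1), e₂ (1, 1))‖ ∧ ‖M - (1, 1)‖ ≤ 1 / 4 ∧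
      (M.1 ^ 2 - M.1 + e₁ M = 0 ∧ M.2 ^ 2 - M.2 + e₂ M = 0) ∧
      ∀ q, ‖q‖ ≤ ρ → q.1 ^ 2 - q.1 + e₁ q = 0 → q.2 ^ 2 - q.2 + e₂ q = 0 →
        q ∈ threeCorners ∨ q = M := by
  obtain ⟨M, hM, hM4, hM1, hM2⟩ := perturbed_zero_exists hρ b₁ b₂
  refine ⟨M, hM, hM4, ⟨hM1, hM2⟩, fun q hq h1 h2 => ?_⟩
  have m1 := abs_le.1 ((norm_fst_le (M - (1, 1))).trans hM4)
  have m2 := abs_le.1 ((norm_snd_le (M - (1, 1))).trans hM4)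
  simp only [Prod.fst_sub, Prod.snd_sub] at m1 m2
  have hMρ : ‖M‖ ≤ ρ := norm_prod_le_of_abs (abs_le.2 ⟨by linarith, by linarith⟩)
    (abs_le.2 ⟨by linarith, by linarith⟩)
  -- Every zero is near one of the four corners, and near each corner uniqueness identifies it with
  -- the known zero.
  have corner : ∀ c ∈ threeCorners, 1 / 2 ≤ |q.1 + c.1 - 1| → 1 / 2 ≤ |q.2 + c.2 - 1| →
      q ∈ threeCorners := by
    intro c hc s1 s2
    have hcρ : ‖c‖ ≤ ρ := by
      have : ‖c‖ ≤ 1 := by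
        rcases hc with rfl | rfl | rfl <;> simp [Prod.norm_def]
      linarith
    rwa [perturbed_zero_unique ((b₁ q hq).2 c hcρ) ((b₂ q hq).2 c hcρ) h1 h2 (hz c hc).1
      (hz c hc).2 s1 s2]
  have low : ∀ {x y : ℝ}, x ≤ 1 / 4 → y = 0 → 1 / 2 ≤ |x + y - 1| := fun hx hy =>
    le_abs.2 (Or.inr (by linarith))
  have high : ∀ {x y : ℝ}, 3 / 4 ≤ x → 3 / 4 ≤ y → 1 / 2 ≤ |x + y - 1| := fun hx hy =>
    le_abs.2 (Or.inl (by linarith))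
  have one : (3 / 4 : ℝ) ≤ 1 := by norm_num
  rcases near_zero_or_one (b₁ q hq).1 h1 with ⟨x1, -⟩ | ⟨x1, -⟩ <;>
    rcases near_zero_or_one (b₂ q hq).1 h2 with ⟨y1, -⟩ | ⟨y1, -⟩
  · exact Or.inl (corner (0, 0) (by simp [threeCorners]) (low x1 rfl) (low y1 rfl))
  · exact Or.inl (corner (0, 1) (by simp [threeCorners]) (low x1 rfl) (high y1 one))
  · exact Or.inl (corner (1, 0) (by simp [threeCorners]) (high x1 one) (low y1 rfl))
  · exact Or.inr (perturbed_zero_unique ((b₁ q hq).2 M hMρ) ((b₂ q hq).2 M hMρ) h1 h2 hM1 hM2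
      (high x1 (by linarith)) (high y1 (by linarith)))

lemma UniformBddLip.eventually_small {ρ : ℝ} {g : ℝ → ℝ × ℝ → ℝ} (hg : UniformBddLip ρ g) :
    ∀ᶠ ε in 𝓝[>] (0 : ℝ), ∀ q, ‖q‖ ≤ ρ → |ε * g ε q| ≤ 1 / 16 ∧
      ∀ q', ‖q'‖ ≤ ρ → |ε * g ε q - ε * g ε q'| ≤ 1 / 16 * ‖q - q'‖ := by
  obtain ⟨K, hK⟩ := hg
  have hs : ∀ᶠ ε in 𝓝[>] (0 : ℝ), ε * K < 1 / 16 := by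
    have : Tendsto (fun ε : ℝ => ε * K) (𝓝[>] 0) (𝓝 0) := by
      simpa using tendsto_param_zero.mul_const K
    exact this.eventually_lt_const (by norm_num)
  filter_upwards [hK, hs, self_mem_nhdsWithin] with ε h1 h2 (h3 : 0 < ε) q hq
  refine ⟨?_, fun q' hq' => ?_⟩
  · rw [abs_mul, abs_of_pos h3]
    exact (mul_le_mul_of_nonneg_left (h1 q hq).1 h3.le).trans h2.le
  · rw [← mul_sub, abs_mul, abs_of_pos h3]
    refine (mul_le_mul_of_nonneg_left ((h1 q hq).2 q' hq') h3.le).trans ?_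
    rw [← mul_assoc]
    exact mul_le_mul_of_nonneg_right h2.le (norm_nonneg _)

/-- A perturbation of the system `x² = x`, `y² = y` which keeps three of its four solutions and
changes it by `O(ε²)` at the fourth one has exactly four solutions, and the fourth one moves by
`O(ε²)`. -/
theorem eventually_four_zeros {ρ : ℝ} (hρ : 2 ≤ ρ) {P₁ P₂ : ℝ → ℝ × ℝ → ℝ}
    (h₁ : FirstOrder ρ P₁ (fun q => q.1 ^ 2 - q.1))
    (h₂ : FirstOrder ρ P₂ (fun q => q.2 ^ 2 - q.2))
    (hz : ∀ᶠ ε in 𝓝[>] (0 : ℝ), ∀ q ∈ threeCorners, P₁ ε q = 0 ∧ P₂ ε q = 0)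
    (o₁ : (fun ε => P₁ ε (1, 1)) =O[𝓝[>] 0] (fun ε : ℝ => ε ^ 2))
    (o₂ : (fun ε => P₂ ε (1, 1)) =O[𝓝[>] 0] (fun ε : ℝ => ε ^ 2)) :
    ∃ K : ℝ, ∀ᶠ ε in 𝓝[>] (0 : ℝ), ∃ M : ℝ × ℝ, ‖M - (1, 1)‖ ≤ K * ε ^ 2 ∧
      ‖M - (1, 1)‖ ≤ 1 / 4 ∧ (P₁ ε M = 0 ∧ P₂ ε M = 0) ∧
      ∀ q, ‖q‖ ≤ ρ → P₁ ε q = 0 → P₂ ε q = 0 → q ∈ threeCorners ∨ q = M := by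
  obtain ⟨-, e₁, b₁, E₁⟩ := h₁
  obtain ⟨-, e₂, b₂, E₂⟩ := h₂
  obtain ⟨K, hK⟩ := (o₁.prod_left o₂).bound
  refine ⟨4 * K, ?_⟩
  filter_upwards [E₁, E₂, b₁.eventually_small, b₂.eventually_small, hz, hK]
    with ε E₁ E₂ b₁ b₂ hz hK
  have n1 : ‖((1, 1) : ℝ × ℝ)‖ ≤ ρ := by simp [Prod.norm_def]; linarith
  have hcρ : ∀ c ∈ threeCorners, ‖c‖ ≤ ρ := by
    intro c hc
    have : ‖c‖ ≤ 1 := by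
      rcases hc with rfl | rfl | rfl <;> simp [Prod.norm_def]
    linarith
  obtain ⟨M, hM, hM4, hM0, hu⟩ := perturbed_zeros hρ b₁ b₂ (fun q hq => by
    rw [← E₁ q (hcρ q hq), ← E₂ q (hcρ q hq)]; exact hz q hq)
  have hMρ : ‖M‖ ≤ ρ := by
    have := norm_le_norm_add_norm_sub' M (1, 1)
    have n1' : ‖((1, 1) : ℝ × ℝ)‖ = 1 := by simp [Prod.norm_def]
    rw [n1'] at this; linarith
  refine ⟨M, hM.trans ?_, hM4, ?_, fun q hq q1 q2 => hu q hq ?_ ?_⟩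
  · have e : (ε * e₁ ε (1, 1), ε * e₂ ε (1, 1)) = (P₁ ε (1, 1), P₂ ε (1, 1)) := by
      rw [E₁ _ n1, E₂ _ n1]; simp
    rw [e, mul_assoc]
    rw [Real.norm_of_nonneg (sq_nonneg ε)] at hK
    linarith
  · rw [E₁ M hMρ, E₂ M hMρ]; exact hM0
  · rw [← E₁ q hq]; exact q1
  · rw [← E₂ q hq]; exact q2

/-! ### Taylor remainders with Lipschitz control. -/

section Taylor

variable {E F : Type*} [NormedAddCommGroup E] [NormedSpace ℝ E] [NormedAddCommGroup F]
  [NormedSpace ℝ F]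

lemma ContDiffAt.exists_norm_sub_fderiv_le {g : E → F} {p : E} (hg : ContDiffAt ℝ 2 g p) :
    ∃ K : ℝ, 0 ≤ K ∧ ∀ᶠ h in 𝓝 (0 : E), ‖g (p + h) - g p - fderiv ℝ g p h‖ ≤ K * ‖h‖ ^ 2 := by
  have h1 : ContDiffAt ℝ 1 (fderiv ℝ g) p := hg.fderiv_right (by norm_num)
  obtain ⟨K, s, hs, hK⟩ := (h1.hasStrictFDerivAt one_ne_zero).exists_lipschitzOnWith
  have hd : ∀ᶠ q in 𝓝 p, DifferentiableAt ℝ g q :=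
    (hg.eventually (by simp)).mono fun q hq => hq.differentiableAt (by norm_num)
  obtain ⟨δ, hδ, hball⟩ := Metric.eventually_nhds_iff_ball.1 (hd.and hs)
  refine ⟨K, K.2, ?_⟩
  filter_upwards [Metric.ball_mem_nhds (0 : E) hδ] with h hh
  rw [mem_ball_zero_iff] at hh
  have hsub : ∀ x ∈ Metric.closedBall p ‖h‖, x ∈ Metric.ball p δ := fun x hx =>
    Metric.closedBall_subset_ball hh hx
  have key := (convex_closedBall p ‖h‖).norm_image_sub_le_of_norm_hasFDerivWithin_le'
    (f := g) (f' := fderiv ℝ g) (φ := fderiv ℝ g p) (C := K * ‖h‖) (x := p) (y := p + h)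
    (fun x hx => (hball x (hsub x hx)).1.hasFDerivAt.hasFDerivWithinAt)
    (fun x hx => by
      have := hK.norm_sub_le (hball x (hsub x hx)).2 (mem_of_mem_nhds hs)
      rw [mem_closedBall_iff_norm] at hx
      exact this.trans (mul_le_mul_of_nonneg_left hx K.2))
    (Metric.mem_closedBall_self (norm_nonneg h)) (by simp)
  rw [add_sub_cancel_left] at key
  rwa [pow_two, ← mul_assoc]

/-- The remainder of the second order Taylor expansion. -/
noncomputable def taylorRemainder (f : E → F) (p h : E) : F :=
  f (p + h) - f p - fderiv ℝ f p h - (1 / 2 : ℝ) • fderiv ℝ (fderiv ℝ f) p h h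

lemma taylorRemainder_zero (f : E → F) (p : E) : taylorRemainder f p 0 = 0 := by
  simp [taylorRemainder]

/-- By symmetry of the second derivative, the derivative of the remainder is the first-order Taylor
error of `fderiv ℝ f`, which is quadratically small; the mean value inequality does the rest. -/
lemma taylorRemainder_lipschitz {f : E → F} {p : E} (hf : ContDiffAt ℝ 3 f p) :
    ∃ K δ : ℝ, 0 ≤ K ∧ 0 < δ ∧ ∀ r < δ, ∀ h h', ‖h‖ ≤ r → ‖h'‖ ≤ r →
      ‖taylorRemainder f p h - taylorRemainder f p h'‖ ≤ K * r ^ 2 * ‖h - h'‖ := by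
  have h1 : ContDiffAt ℝ 2 (fderiv ℝ f) p := hf.fderiv_right (by norm_num)
  obtain ⟨K, hK0, hK⟩ := h1.exists_norm_sub_fderiv_le
  have hd : ∀ᶠ h in 𝓝 (0 : E), DifferentiableAt ℝ f (p + h) := by
    have : ∀ᶠ q in 𝓝 p, DifferentiableAt ℝ f q :=
      (hf.eventually (by simp)).mono fun q hq => hq.differentiableAt (by norm_num)
    have ht : Tendsto (fun h : E => p + h) (𝓝 0) (𝓝 p) := by
      simpa using (continuous_const_add p).tendsto (0 : E)
    exact ht.eventually this
  have hsymm : IsSymmSndFDerivAt ℝ f p := (hf.of_le (by norm_num)).isSymmSndFDerivAt (n := 2)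
    (by simp)
  obtain ⟨δ, hδ, hball⟩ := Metric.eventually_nhds_iff_ball.1 (hd.and hK)
  refine ⟨K, δ, hK0, hδ, fun r hr h h' hh hh' => ?_⟩
  refine (convex_closedBall (0 : E) r).norm_image_sub_le_of_norm_hasFDerivWithin_le
    (f := taylorRemainder f p)
    (f' := fun x => fderiv ℝ f (p + x) - fderiv ℝ f p - fderiv ℝ (fderiv ℝ f) p x)
    (fun x hx => ?_) (fun x hx => ?_) (by simpa using hh') (by simpa using hh)
  · have hx' : x ∈ Metric.ball (0 : E) δ := Metric.closedBall_subset_ball hr hx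
    have d1 : HasFDerivAt (fun x => f (p + x)) (fderiv ℝ f (p + x)) x :=
      (hball x hx').1.hasFDerivAt.comp x ((hasFDerivAt_id x).const_add p)
    have d2 : HasFDerivAt (fun x => fderiv ℝ f p x) (fderiv ℝ f p) x :=
      (fderiv ℝ f p).hasFDerivAt
    have d3 := ((fderiv ℝ (fderiv ℝ f) p).hasFDerivAt (x := x)).clm_apply (hasFDerivAt_id x)
    have d := ((d1.sub_const (f p)).sub d2).sub (d3.const_smul (1 / 2 : ℝ))
    refine (d.congr_fderiv ?_).hasFDerivWithinAt
    ext y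
    simp only [sub_apply, smul_apply,
      add_apply, ContinuousLinearMap.comp_apply,
      ContinuousLinearMap.flip_apply, ContinuousLinearMap.id_apply, id]
    rw [hsymm.eq y x, ← two_smul ℝ, smul_smul]
    norm_num
  · have hx' : x ∈ Metric.ball (0 : E) δ := Metric.closedBall_subset_ball hr hx
    refine (hball x hx').2.trans (mul_le_mul_of_nonneg_left ?_ hK0)
    exact pow_le_pow_left₀ (norm_nonneg _) (by simpa using hx) 2

lemma taylorRemainder_rescaled {f : E → F} {p : E} (hf : ContDiffAt ℝ 3 f p) {ρ : ℝ}
    (hρ : 0 ≤ ρ) : ∃ K : ℝ, ∀ᶠ ε in 𝓝[>] (0 : ℝ), ∀ q, ‖q‖ ≤ ρ →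
      ‖(ε ^ 3)⁻¹ • taylorRemainder f p (ε • q)‖ ≤ K ∧ ∀ q', ‖q'‖ ≤ ρ →
      ‖(ε ^ 3)⁻¹ • taylorRemainder f p (ε • q) - (ε ^ 3)⁻¹ • taylorRemainder f p (ε • q')‖
        ≤ K * ‖q - q'‖ := by
  obtain ⟨K, δ, hK, hδ, H⟩ := taylorRemainder_lipschitz hf
  have hs : ∀ᶠ ε in 𝓝[>] (0 : ℝ), ε * ρ < δ := by
    have : Tendsto (fun ε : ℝ => ε * ρ) (𝓝[>] 0) (𝓝 0) := by
      simpa using tendsto_param_zero.mul_const ρ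
    exact this.eventually_lt_const hδ
  refine ⟨max (K * ρ ^ 2) (K * ρ ^ 2 * ρ), ?_⟩
  filter_upwards [hs, self_mem_nhdsWithin] with ε h1 (h2 : 0 < ε)
  have key : ∀ q q' : E, ‖q‖ ≤ ρ → ‖q'‖ ≤ ρ →
      ‖(ε ^ 3)⁻¹ • taylorRemainder f p (ε • q) - (ε ^ 3)⁻¹ • taylorRemainder f p (ε • q')‖
        ≤ K * ρ ^ 2 * ‖q - q'‖ := by
    intro q q' hq hq'
    have hn : ∀ q : E, ‖q‖ ≤ ρ → ‖ε • q‖ ≤ ε * ρ := fun q hq => by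
      rw [norm_smul, Real.norm_of_nonneg h2.le]
      exact mul_le_mul_of_nonneg_left hq h2.le
    have := H (ε * ρ) h1 _ _ (hn q hq) (hn q' hq')
    rw [← smul_sub, norm_smul, Real.norm_of_nonneg (by positivity)] at this ⊢
    calc _ ≤ (ε ^ 3)⁻¹ * (K * (ε * ρ) ^ 2 * (ε * ‖q - q'‖)) :=
          mul_le_mul_of_nonneg_left this (by positivity)
      _ = _ := by field_simp
  intro q hq
  refine ⟨?_, fun q' hq' => (key q q' hq hq').trans
    (mul_le_mul_of_nonneg_right (le_max_left _ _) (norm_nonneg _))⟩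
  have := key q 0 hq (by simpa using hρ)
  rw [smul_zero, taylorRemainder_zero, smul_zero, sub_zero, sub_zero] at this
  exact this.trans ((mul_le_mul_of_nonneg_left hq (by positivity)).trans (le_max_right _ _))

end Taylor

/-! ### The mixed second difference over a small square. -/

section TwoVariables

variable {F : Type*} [NormedAddCommGroup F] [NormedSpace ℝ F]

lemma hasDerivAt_comp_fst {g : ℝ × ℝ → F} {p : ℝ × ℝ} {s t : ℝ}
    (h : DifferentiableAt ℝ g (p + (s, t))) :
    HasDerivAt (fun s => g (p + (s, t))) (fderiv ℝ g (p + (s, t)) (1, 0)) s := by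
  have h1 : HasDerivAt (fun s : ℝ => p + (s, t)) ((1 : ℝ), (0 : ℝ)) s :=
    ((hasDerivAt_id s).prodMk (hasDerivAt_const s t)).const_add p
  exact h.hasFDerivAt.comp_hasDerivAt s h1

lemma hasDerivAt_comp_snd {g : ℝ × ℝ → F} {p : ℝ × ℝ} {s t : ℝ}
    (h : DifferentiableAt ℝ g (p + (s, t))) :
    HasDerivAt (fun t => g (p + (s, t))) (fderiv ℝ g (p + (s, t)) (0, 1)) t := by
  have h1 : HasDerivAt (fun t : ℝ => p + (s, t)) ((0 : ℝ), (1 : ℝ)) t :=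
    ((hasDerivAt_const t s).prodMk (hasDerivAt_id t)).const_add p
  exact h.hasFDerivAt.comp_hasDerivAt t h1

/-- The mixed second derivative `f_uv`. -/
noncomputable def mixedDeriv (f : ℝ × ℝ → F) (q : ℝ × ℝ) : F :=
  fderiv ℝ (fderiv ℝ f) q (1, 0) (0, 1)

lemma ContDiffAt.mixedDeriv {f : ℝ × ℝ → F} {p : ℝ × ℝ} (hf : ContDiffAt ℝ 4 f p) :
    ContDiffAt ℝ 2 (mixedDeriv f) p := by
  have h1 : ContDiffAt ℝ 3 (fderiv ℝ f) p := hf.fderiv_right (by norm_num)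
  have h2 : ContDiffAt ℝ 2 (fderiv ℝ (fderiv ℝ f)) p := h1.fderiv_right (by norm_num)
  exact (h2.clm_apply contDiffAt_const).clm_apply contDiffAt_const

/-- The mixed difference is the double integral of f_uv over the square; its first-order Taylor
polynomial integrates to the stated terms. Two mean value inequalities replace the integrals. -/
lemma mixedDifference_isBigO {f : ℝ × ℝ → F} {p : ℝ × ℝ} (hf : ContDiffAt ℝ 4 f p) :
    (fun ε : ℝ => f (p + (ε, ε)) - f (p + (ε, 0)) - f (p + (0, ε)) + f p
      - (ε ^ 2 • mixedDeriv f p + (ε ^ 3 / 2) • (fderiv ℝ (mixedDeriv f) p (1, 0)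
        + fderiv ℝ (mixedDeriv f) p (0, 1)))) =O[𝓝[>] 0] (fun ε : ℝ => ε ^ 4) := by
  set m := mixedDeriv f p
  set m₁ := fderiv ℝ (mixedDeriv f) p (1, 0)
  set m₂ := fderiv ℝ (mixedDeriv f) p (0, 1)
  obtain ⟨K, hK0, hK⟩ := hf.mixedDeriv.exists_norm_sub_fderiv_le
  have hd : ∀ᶠ h in 𝓝 (0 : ℝ × ℝ), ContDiffAt ℝ 4 f (p + h) := by
    have ht : Tendsto (fun h : ℝ × ℝ => p + h) (𝓝 0) (𝓝 p) := by
      simpa using (continuous_const_add p).tendsto (0 : ℝ × ℝ)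
    exact ht.eventually (hf.eventually (by simp))
  obtain ⟨δ, hδ, hball⟩ := Metric.eventually_nhds_iff_ball.1 (hd.and hK)
  refine IsBigO.of_bound K ?_
  filter_upwards [Ioo_mem_nhdsGT hδ] with ε hε
  have hε0 : 0 ≤ ε := hε.1.le
  have hmem : ∀ {s t : ℝ}, s ∈ Set.Icc 0 ε → t ∈ Set.Icc 0 ε →
      ‖(s, t)‖ ≤ ε ∧ (s, t) ∈ Metric.ball (0 : ℝ × ℝ) δ := by
    intro s t hs ht
    have : ‖(s, t)‖ ≤ ε := norm_prod_le_of_abs (by rw [abs_of_nonneg hs.1]; exact hs.2)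
      (by rw [abs_of_nonneg ht.1]; exact ht.2)
    exact ⟨this, by rw [mem_ball_zero_iff]; exact this.trans_lt hε.2⟩
  have inner_bound : ∀ s ∈ Set.Icc 0 ε, ‖fderiv ℝ f (p + (s, ε)) (1, 0)
      - fderiv ℝ f (p + (s, 0)) (1, 0) - (ε • m + (s * ε) • m₁ + (ε ^ 2 / 2) • m₂)‖
      ≤ K * ε ^ 2 * ε := by
    intro s hs
    -- The subtracted term is a primitive in t of the Taylor polynomial of f_uv, so the derivative
    -- is exactly its Taylor error.
    have key := norm_image_sub_le_of_norm_deriv_le_segment' (a := 0) (b := ε)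
      (f := fun t => fderiv ℝ f (p + (s, t)) (1, 0) - (t • m + (s * t) • m₁ + (t ^ 2 / 2) • m₂))
      (f' := fun t => fderiv ℝ (fderiv ℝ f) (p + (s, t)) (0, 1) (1, 0)
        - (m + s • m₁ + t • m₂)) (C := K * ε ^ 2) ?_ ?_ ε ⟨hε0, le_rfl⟩
    · refine le_trans (le_of_eq ?_) (key.trans (le_of_eq (by ring)))
      congr 1
      simp
      abel
    · intro t ht
      have c := (hball _ (hmem hs ht).2).1
      have c' : DifferentiableAt ℝ (fderiv ℝ f) (p + (s, t)) :=
        (c.fderiv_right (m := 1) (by norm_num)).differentiableAt (by norm_num)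
      have d1 := (hasDerivAt_comp_snd c').clm_apply (hasDerivAt_const t ((1 : ℝ), (0 : ℝ)))
      have d2 := (hasDerivAt_id t).smul_const m
      have d3 := ((hasDerivAt_id t).const_mul s).smul_const m₁
      have d4 := (((hasDerivAt_id t).pow 2).div_const 2).smul_const m₂
      refine ((d1.sub ((d2.add d3).add d4)).congr_deriv ?_).hasDerivWithinAt
      simp
    · intro t ht
      have hst := hmem hs ⟨ht.1, ht.2.le⟩
      have c := (hball _ hst.2).1
      have hsymm : IsSymmSndFDerivAt ℝ f (p + (s, t)) :=
        (c.of_le (by norm_num)).isSymmSndFDerivAt (n := 2) (by simp)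
      rw [hsymm.eq]
      have e : fderiv ℝ (mixedDeriv f) p (s, t) = s • m₁ + t • m₂ := by
        rw [← map_smul, ← map_smul, ← map_add]; simp
      have := (hball _ hst.2).2
      rw [e] at this
      refine le_trans (le_of_eq ?_) (this.trans (mul_le_mul_of_nonneg_left
        (pow_le_pow_left₀ (norm_nonneg _) hst.1 2) hK0))
      rw [mixedDeriv]
      congr 1
      abel
  have key := norm_image_sub_le_of_norm_deriv_le_segment' (a := 0) (b := ε)
    (f := fun s => f (p + (s, ε)) - f (p + (s, 0))
      - ((s * ε) • m + (s ^ 2 / 2 * ε) • m₁ + (s * (ε ^ 2 / 2)) • m₂))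
    (f' := fun s => fderiv ℝ f (p + (s, ε)) (1, 0)
      - fderiv ℝ f (p + (s, 0)) (1, 0) - (ε • m + (s * ε) • m₁ + (ε ^ 2 / 2) • m₂))
    (C := K * ε ^ 2 * ε) ?_ (fun s hs => inner_bound s ⟨hs.1, hs.2.le⟩) ε ⟨hε0, le_rfl⟩
  · rw [Real.norm_of_nonneg (by positivity : (0 : ℝ) ≤ ε ^ 4)]
    refine le_trans (le_of_eq ?_) (key.trans (le_of_eq (by ring)))
    congr 1
    have : (p + (0, 0) : ℝ × ℝ) = p := by rw [Prod.mk_zero_zero, add_zero]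
    simp only [this]
    module
  · intro s hs
    have c : ∀ t ∈ Set.Icc 0 ε, DifferentiableAt ℝ f (p + (s, t)) := fun t ht =>
      (hball _ (hmem hs ht).2).1.differentiableAt (by norm_num)
    have d1 := hasDerivAt_comp_fst (c ε ⟨hε0, le_rfl⟩)
    have d2 := hasDerivAt_comp_fst (c 0 ⟨le_rfl, hε0⟩)
    have d3 := ((hasDerivAt_id s).mul_const ε).smul_const m
    have d4 := ((((hasDerivAt_id s).pow 2).div_const 2).mul_const ε).smul_const m₁
    have d5 := ((hasDerivAt_id s).mul_const (ε ^ 2 / 2)).smul_const m₂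
    refine (((d1.sub d2).sub ((d3.add d4).add d5)).congr_deriv ?_).hasDerivWithinAt
    simp

end TwoVariables

/-! ### Infinitesimal relations of a curvature-line net. -/

lemma gram2_eq_inner_cross3 (a b : E3) : gram2 a b = inner ℝ (cross3 a b) (cross3 a b) := by
  simp only [gram2, E3.inner_eq]
  simp [cross3, cross_apply]
  ring

lemma gram2_ne_zero {a b : E3} (h : LinearIndependent ℝ ![a, b]) : gram2 a b ≠ 0 := by
  intro h0
  rw [LinearIndependent.pair_iff] at h
  have h1 : inner ℝ (inner ℝ b b • a + (-inner ℝ a b) • b)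
      (inner ℝ b b • a + (-inner ℝ a b) • b) = inner ℝ b b * gram2 a b := by
    simp only [gram2, inner_add_left, inner_add_right, real_inner_smul_left,
      real_inner_smul_right, real_inner_comm a b]
    ring
  rw [h0, mul_zero, inner_self_eq_zero] at h1
  have h2 : b = 0 := inner_self_eq_zero.1 (h _ _ h1).1
  have h3 := (h 0 1 (by rw [h2]; simp)).2
  exact one_ne_zero h3

lemma secondForm_eq (f : ℝ × ℝ → E3) (p w x : ℝ × ℝ) : secondForm f p w x =
    ‖cross3 (partialU f p) (partialV f p)‖⁻¹ *
      det3 (fderiv ℝ (fderiv ℝ f) p w x) (partialU f p) (partialV f p) := by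
  rw [secondForm, unitNormal, real_inner_smul_left, det3, real_inner_comm]

/-- The coefficient of the second fundamental form at `(w, x)` up to the factor `|f_u × f_v|`. -/
noncomputable def detForm (f : ℝ × ℝ → E3) (p w x : ℝ × ℝ) : ℝ :=
  det3 (fderiv ℝ (fderiv ℝ f) p w x) (partialU f p) (partialV f p)

lemma bilin_expand {B : (ℝ × ℝ) →L[ℝ] (ℝ × ℝ) →L[ℝ] E3} (w x : ℝ × ℝ) :
    B w x = (w.1 * x.1) • B (1, 0) (1, 0) + (w.1 * x.2) • B (1, 0) (0, 1)
      + (w.2 * x.1) • B (0, 1) (1, 0) + (w.2 * x.2) • B (0, 1) (0, 1) := by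
  have hw : ∀ w : ℝ × ℝ, w = w.1 • (1, 0) + w.2 • (0, 1) := fun w => by ext <;> simp
  conv_lhs => rw [hw w, hw x]
  simp only [map_add, map_smul, add_apply, smul_apply, smul_add, smul_smul]
  module

lemma secondForm_expand (f : ℝ × ℝ → E3) (p w x : ℝ × ℝ) : secondForm f p w x =
    (w.1 * x.1) * secondForm f p (1, 0) (1, 0) + (w.1 * x.2) * secondForm f p (1, 0) (0, 1)
      + (w.2 * x.1) * secondForm f p (0, 1) (1, 0)
      + (w.2 * x.2) * secondForm f p (0, 1) (0, 1) := by
  simp only [secondForm]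
  rw [bilin_expand w x]
  simp only [inner_add_right, real_inner_smul_right]

lemma firstForm_expand (f : ℝ × ℝ → E3) (p w x : ℝ × ℝ) : firstForm f p w x =
    (w.1 * x.1) * firstForm f p (1, 0) (1, 0) + (w.1 * x.2) * firstForm f p (1, 0) (0, 1)
      + (w.2 * x.1) * firstForm f p (0, 1) (1, 0)
      + (w.2 * x.2) * firstForm f p (0, 1) (0, 1) := by
  have hw : ∀ w : ℝ × ℝ, w = w.1 • (1, 0) + w.2 • (0, 1) := fun w => by ext <;> simp
  simp only [firstForm]
  conv_lhs => rw [hw w, hw x]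
  simp only [map_add, map_smul, inner_add_left, inner_add_right, real_inner_smul_left,
    real_inner_smul_right]
  ring

namespace IsCurvatureLineNet

variable {f : ℝ × ℝ → E3} {Ω : Set (ℝ × ℝ)} {p : ℝ × ℝ}

lemma contDiffAt (hf : IsCurvatureLineNet f Ω) (hp : p ∈ Ω) (n : ℕ) : ContDiffAt ℝ n f p :=
  (hf.smooth.contDiffAt (hf.isOpen.mem_nhds hp)).of_le (by exact_mod_cast le_top)

lemma gram2_ne_zero (hf : IsCurvatureLineNet f Ω) (hp : p ∈ Ω) :
    gram2 (partialU f p) (partialV f p) ≠ 0 := _root_.gram2_ne_zero (hf.regular p hp)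

lemma norm_cross_ne_zero (hf : IsCurvatureLineNet f Ω) (hp : p ∈ Ω) :
    ‖cross3 (partialU f p) (partialV f p)‖⁻¹ ≠ 0 := by
  have := hf.gram2_ne_zero hp
  rw [gram2_eq_inner_cross3, real_inner_self_eq_norm_sq] at this
  exact inv_ne_zero (fun h => this (by rw [h]; simp))

lemma symm (hf : IsCurvatureLineNet f Ω) (hp : p ∈ Ω) : IsSymmSndFDerivAt ℝ f p :=
  (hf.contDiffAt hp 2).isSymmSndFDerivAt (n := 2) (by simp)

lemma inner_self_pos (hf : IsCurvatureLineNet f Ω) (hp : p ∈ Ω) :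
    0 < (inner ℝ (partialU f p) (partialU f p) : ℝ) ∧
      0 < (inner ℝ (partialV f p) (partialV f p) : ℝ) := by
  have h := hf.regular p hp
  constructor
  · exact real_inner_self_pos.2 (h.ne_zero 0)
  · exact real_inner_self_pos.2 (h.ne_zero 1)

/-- The principal curvatures differ, since otherwise bilinearity makes p umbilic. Symmetry of both
forms gives κ₁⟨f_u, f_v⟩ = κ₂⟨f_u, f_v⟩, hence orthogonality, and then the mixed coefficient of the
second form vanishes. The last inequality is κ₁ ≠ κ₂ with denominators cleared. -/
lemma of_not_isUmbilic (hf : IsCurvatureLineNet f Ω) (hp : p ∈ Ω) (hnu : ¬ IsUmbilic f p) :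
    inner ℝ (partialU f p) (partialV f p) = (0 : ℝ) ∧
      det3 (mixedDeriv f p) (partialU f p) (partialV f p) = 0 ∧
      detForm f p (1, 0) (1, 0) * inner ℝ (partialV f p) (partialV f p) ≠
        detForm f p (0, 1) (0, 1) * inner ℝ (partialU f p) (partialU f p) := by
  obtain ⟨-, κ₁, h1⟩ := hf.principal_u p hp
  obtain ⟨-, κ₂, h2⟩ := hf.principal_v p hp
  have hc := hf.norm_cross_ne_zero hp
  have hne : κ₁ ≠ κ₂ := by
    rintro rfl
    refine hnu ⟨κ₁, fun w x => ?_⟩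
    rw [secondForm_expand, firstForm_expand, h1, h1, h2, h2]
    ring
  have hs : secondForm f p (0, 1) (1, 0) = secondForm f p (1, 0) (0, 1) := by
    rw [secondForm_eq, secondForm_eq, (hf.symm hp).eq]
  have hs' : firstForm f p (0, 1) (1, 0) = firstForm f p (1, 0) (0, 1) := real_inner_comm _ _
  have hF : firstForm f p (1, 0) (0, 1) = 0 := by
    have := (h2 (1, 0)).symm.trans (hs.trans (h1 (0, 1)))
    rw [hs'] at this
    by_contra h
    exact hne (mul_right_cancel₀ h this).symm
  refine ⟨hF, ?_, fun h => hne ?_⟩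
  · have := h1 (0, 1)
    rw [hF, mul_zero, secondForm_eq] at this
    exact (mul_eq_zero.1 this).resolve_left hc
  · have e1 := h1 (1, 0)
    have e2 := h2 (0, 1)
    rw [secondForm_eq] at e1 e2
    change _ * detForm f p (1, 0) (1, 0) = κ₁ * inner ℝ (partialU f p) (partialU f p) at e1
    change _ * detForm f p (0, 1) (0, 1) = κ₂ * inner ℝ (partialV f p) (partialV f p) at e2
    obtain ⟨p1, p2⟩ := hf.inner_self_pos hp
    refine mul_right_cancel₀ (mul_pos p1 p2).ne' ?_
    linear_combination ‖cross3 (partialU f p) (partialV f p)‖⁻¹ * h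
      - inner ℝ (partialV f p) (partialV f p) * e1 + inner ℝ (partialU f p) (partialU f p) * e2

lemma not_isUmbilic_of_ne
    (h : detForm f p (1, 0) (1, 0) * inner ℝ (partialV f p) (partialV f p) ≠
        detForm f p (0, 1) (0, 1) * inner ℝ (partialU f p) (partialU f p))
    (hf : IsCurvatureLineNet f Ω) (hp : p ∈ Ω) : ¬ IsUmbilic f p := by
  rintro ⟨κ, hκ⟩
  have e1 := hκ (1, 0) (1, 0)
  have e2 := hκ (0, 1) (0, 1)
  rw [secondForm_eq] at e1 e2
  change _ * detForm f p (1, 0) (1, 0) = κ * inner ℝ (partialU f p) (partialU f p) at e1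
  change _ * detForm f p (0, 1) (0, 1) = κ * inner ℝ (partialV f p) (partialV f p) at e2
  refine h (mul_left_cancel₀ (hf.norm_cross_ne_zero hp) ?_)
  linear_combination inner ℝ (partialV f p) (partialV f p) * e1
    - inner ℝ (partialU f p) (partialU f p) * e2

lemma contDiffAt_partial (hf : IsCurvatureLineNet f Ω) (hp : p ∈ Ω) (d : ℝ × ℝ) :
    ContDiffAt ℝ 2 (fun q => fderiv ℝ f q d) p :=
  ((hf.contDiffAt hp 3).fderiv_right (m := 2) (by norm_num)).clm_apply contDiffAt_const

lemma contDiffAt_mixedDeriv (hf : IsCurvatureLineNet f Ω) (hp : p ∈ Ω) :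
    ContDiffAt ℝ 2 (mixedDeriv f) p := (hf.contDiffAt hp 4).mixedDeriv

lemma continuousAt_detForm (hf : IsCurvatureLineNet f Ω) (hp : p ∈ Ω) (w x : ℝ × ℝ) :
    ContinuousAt (fun q => detForm f q w x) p := by
  have h1 : ContinuousAt (fun q => fderiv ℝ (fderiv ℝ f) q w x) p :=
    (((((hf.contDiffAt hp 4).fderiv_right (m := 3) (by norm_num)).fderiv_right (m := 2)
      (by norm_num)).clm_apply contDiffAt_const).clm_apply contDiffAt_const).continuousAt
  have h2 : ContinuousAt (partialU f) p := (hf.contDiffAt_partial hp (1, 0)).continuousAt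
  have h3 : ContinuousAt (partialV f) p := (hf.contDiffAt_partial hp (0, 1)).continuousAt
  simp only [detForm, det3_eq]
  fun_prop

/-- Non-umbilicity is an inequality between continuous functions. Its openness is what allows the
relations at p to be differentiated. -/
lemma eventually_not_isUmbilic (hf : IsCurvatureLineNet f Ω) (hp : p ∈ Ω)
    (hnu : ¬ IsUmbilic f p) : ∀ᶠ q in 𝓝 p, q ∈ Ω ∧ ¬ IsUmbilic f q := by
  have h2 : ContinuousAt (partialU f) p := (hf.contDiffAt_partial hp (1, 0)).continuousAt
  have h3 : ContinuousAt (partialV f) p := (hf.contDiffAt_partial hp (0, 1)).continuousAt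
  have c1 := (hf.continuousAt_detForm hp (1, 0) (1, 0)).mul (h3.inner h3)
  have c2 := (hf.continuousAt_detForm hp (0, 1) (0, 1)).mul (h2.inner h2)
  filter_upwards [(c1.ne_iff_eventually_ne c2).1 (hf.of_not_isUmbilic hp hnu).2.2,
    hf.isOpen.mem_nhds hp] with q h hq
  exact ⟨hq, not_isUmbilic_of_ne h hf hq⟩

end IsCurvatureLineNet

lemma tendsto_add_smul_nhds (p d : ℝ × ℝ) :
    Tendsto (fun ε : ℝ => p + ε • d) (𝓝[>] 0) (𝓝 p) := by
  have := (tendsto_param_zero.smul_const d).const_add p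
  simpa using this

lemma JetE3.of_contDiffAt {g : ℝ × ℝ → E3} {p : ℝ × ℝ} (hg : ContDiffAt ℝ 2 g p) (d : ℝ × ℝ) :
    JetE3 (fun ε => g (p + ε • d)) (g p) (fderiv ℝ g p d) := by
  obtain ⟨K, hK0, hK⟩ := hg.exists_norm_sub_fderiv_le
  have ht : Tendsto (fun ε : ℝ => ε • d) (𝓝[>] 0) (𝓝 0) := by
    simpa using tendsto_param_zero.smul_const d
  refine JetE3.of_isBigO (IsBigO.of_bound (K * ‖d‖ ^ 2) ?_)
  filter_upwards [ht.eventually hK] with ε h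
  rw [map_smul, norm_smul, mul_pow] at h
  rw [norm_pow]
  linarith

/-- The infinitesimal relations satisfied by a net of curvature lines at a point which is not
umbilic, where `a = f_u`, `b = f_v` and `fuvuv = f_uuv + f_uvv`. -/
structure CurvatureLineJet (a b fuu fuv fvv fuvuv : E3) : Prop where
  inner_ab : inner ℝ a b = (0 : ℝ)
  det_uv : det3 fuv a b = 0
  inner_u : inner ℝ fuu b + inner ℝ a fuv = (0 : ℝ)
  inner_v : inner ℝ fuv b + inner ℝ a fvv = (0 : ℝ)
  det_uvuv : det3 fuvuv a b + det3 fuv fuu b + det3 fuv a fvv = 0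
  det_ne : det3 fuu a b * inner ℝ b b ≠ det3 fvv a b * inner ℝ a a

lemma det3_add_left (x x' y z : E3) : det3 (x + x') y z = det3 x y z + det3 x' y z := by
  rw [det3, inner_add_left]; rfl

lemma det3_smul_left (c : ℝ) (x y z : E3) : det3 (c • x) y z = c * det3 x y z := by
  rw [det3, real_inner_smul_left]; rfl

lemma det3_self_right (x y : E3) : det3 x y x = 0 := by
  rw [det3_eq]; ring

lemma det3_self_left (x y : E3) : det3 x x y = 0 := by
  rw [det3_eq]; ring

/-- Differentiate ⟨f_u, f_v⟩ = 0 and det(f_uv, f_u, f_v) = 0 along both axes. In the determinant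
each direction produces one term with f_uv repeated, which drops out; the two remaining identities
are added. -/
lemma IsCurvatureLineNet.jet {f : ℝ × ℝ → E3} {Ω : Set (ℝ × ℝ)} {p : ℝ × ℝ}
    (hf : IsCurvatureLineNet f Ω) (hp : p ∈ Ω) (hnu : ¬ IsUmbilic f p) :
    CurvatureLineJet (partialU f p) (partialV f p)
      (fderiv ℝ (fderiv ℝ f) p (1, 0) (1, 0)) (mixedDeriv f p)
      (fderiv ℝ (fderiv ℝ f) p (0, 1) (0, 1))
      (fderiv ℝ (mixedDeriv f) p (1, 0) + fderiv ℝ (mixedDeriv f) p (0, 1)) := by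
  obtain ⟨h1, h2, h3⟩ := hf.of_not_isUmbilic hp hnu
  have hev := hf.eventually_not_isUmbilic hp hnu
  have hD : DifferentiableAt ℝ (fderiv ℝ f) p :=
    ((hf.contDiffAt hp 2).fderiv_right (m := 1) (by norm_num)).differentiableAt (by norm_num)
  have hpart : ∀ d e, fderiv ℝ (fun q => fderiv ℝ f q e) p d = fderiv ℝ (fderiv ℝ f) p d e := by
    intro d e
    rw [fderiv_clm_apply hD (differentiableAt_const e)]
    simp
  have ju : ∀ d, JetE3 (fun ε => partialU f (p + ε • d)) (partialU f p)
      (fderiv ℝ (fderiv ℝ f) p d (1, 0)) := fun d => by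
    rw [← hpart]; exact JetE3.of_contDiffAt (hf.contDiffAt_partial hp (1, 0)) d
  have jv : ∀ d, JetE3 (fun ε => partialV f (p + ε • d)) (partialV f p)
      (fderiv ℝ (fderiv ℝ f) p d (0, 1)) := fun d => by
    rw [← hpart]; exact JetE3.of_contDiffAt (hf.contDiffAt_partial hp (0, 1)) d
  have jm := fun d => JetE3.of_contDiffAt (hf.contDiffAt_mixedDeriv hp) d
  have ev := fun d => (tendsto_add_smul_nhds p d).eventually hev
  have zi := fun d => (((ju d).inner (jv d)).eq_zero
    ((ev d).mono fun ε h => (hf.of_not_isUmbilic h.1 h.2).1)).2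
  have zd := fun d => (((jm d).det3 (ju d) (jv d)).eq_zero
    ((ev d).mono fun ε h => (hf.of_not_isUmbilic h.1 h.2).2.1)).2
  have hs : fderiv ℝ (fderiv ℝ f) p (0, 1) (1, 0) = mixedDeriv f p := (hf.symm hp).eq _ _
  refine ⟨h1, h2, zi (1, 0), ?_, ?_, h3⟩
  · have := zi (0, 1)
    rwa [hs] at this
  · have z1 := zd (1, 0)
    have z2 := zd (0, 1)
    rw [hs, det3_self_left] at z2
    change _ + _ + det3 (mixedDeriv f p) (partialU f p) (mixedDeriv f p) = 0 at z1
    rw [det3_self_right] at z1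
    rw [det3_add_left]
    linarith

/-! ### Expansion of the magnified surface. -/

/-- The surface magnified by the factor `ε⁻¹` around the point with parameter `p`. -/
noncomputable def rescaled (f : ℝ × ℝ → E3) (p : ℝ × ℝ) (ε : ℝ) (q : ℝ × ℝ) : E3 :=
  ε⁻¹ • (f (p + ε • q) - f p)

/-- The deviation of the magnified surface from the plane through three of its points. -/
noncomputable def rescaledDeviation (f : ℝ × ℝ → E3) (p : ℝ × ℝ) (ε : ℝ) (q : ℝ × ℝ) : E3 :=
  ε⁻¹ • (rescaled f p ε q - q.1 • rescaled f p ε (1, 0) - q.2 • rescaled f p ε (0, 1))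

/-- The second order part of the magnified surface. -/
noncomputable def quadraticPart (f : ℝ × ℝ → E3) (p q : ℝ × ℝ) : E3 :=
  (q.1 ^ 2 / 2) • fderiv ℝ (fderiv ℝ f) p (1, 0) (1, 0) + (q.1 * q.2) • mixedDeriv f p
    + (q.2 ^ 2 / 2) • fderiv ℝ (fderiv ℝ f) p (0, 1) (0, 1)

lemma fderiv_eq_partial (f : ℝ × ℝ → E3) (p q : ℝ × ℝ) :
    fderiv ℝ f p q = q.1 • partialU f p + q.2 • partialV f p := by
  have hq : q = q.1 • (1, 0) + q.2 • (0, 1) := by ext <;> simp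
  conv_lhs => rw [hq]
  rw [map_add, map_smul, map_smul]
  rfl

section Rescaled

variable {f : ℝ × ℝ → E3} {p : ℝ × ℝ}

lemma norm_corners_le {ρ : ℝ} (hρ : 1 ≤ ρ) :
    ‖((1, 0) : ℝ × ℝ)‖ ≤ ρ ∧ ‖((0, 1) : ℝ × ℝ)‖ ≤ ρ ∧ ‖((1, 1) : ℝ × ℝ)‖ ≤ ρ := by
  simp [Prod.norm_def, hρ]

lemma rescaled_eq (hf : ContDiffAt ℝ 3 f p) {ε : ℝ} (hε : ε ≠ 0) (q : ℝ × ℝ) :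
    rescaled f p ε q = (q.1 • partialU f p + q.2 • partialV f p) + ε • quadraticPart f p q
      + ε ^ 2 • ((ε ^ 3)⁻¹ • taylorRemainder f p (ε • q)) := by
  have hsymm : IsSymmSndFDerivAt ℝ f p := (hf.of_le (by norm_num)).isSymmSndFDerivAt (n := 2)
    (by simp)
  have h2 : (1 / 2 : ℝ) • fderiv ℝ (fderiv ℝ f) p q q = quadraticPart f p q := by
    rw [bilin_expand, hsymm.eq (0, 1) (1, 0), quadraticPart, mixedDeriv]
    module
  have hs : ε ^ 2 * (ε ^ 3)⁻¹ = ε⁻¹ := by field_simp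
  have h3 : (1 / 2 : ℝ) • fderiv ℝ (fderiv ℝ f) p (ε • q) (ε • q) =
      ε • ε • quadraticPart f p q := by
    rw [← h2, map_smul, map_smul, smul_apply]
    module
  rw [smul_smul, hs, rescaled, taylorRemainder, h3, map_smul, ← fderiv_eq_partial]
  simp only [smul_sub, inv_smul_smul₀ hε]
  abel

lemma uniformBddLip_remainder (hf : ContDiffAt ℝ 3 f p) {ρ : ℝ} (hρ : 0 ≤ ρ) (i : Fin 3) :
    UniformBddLip ρ (fun ε q => ((ε ^ 3)⁻¹ • taylorRemainder f p (ε • q)) i) := by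
  obtain ⟨K, hK⟩ := taylorRemainder_rescaled hf hρ
  refine ⟨K, ?_⟩
  filter_upwards [hK] with ε h q hq
  exact ⟨(PiLp.norm_apply_le _ i).trans (h q hq).1, fun q' hq' =>
    (PiLp.norm_apply_le (_ - _) i).trans ((h q hq).2 q' hq')⟩

lemma uniformBddLip_quadratic {ρ : ℝ} (x y z : ℝ) :
    UniformBddLip ρ (fun _ q => q.1 ^ 2 / 2 * x + q.1 * q.2 * y + q.2 ^ 2 / 2 * z) := by
  simp only [pow_two, div_eq_mul_inv]
  exact ((((UniformBddLip.fst.mul .fst).mul (.const _)).mul (.const _)).add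
    ((UniformBddLip.fst.mul .snd).mul (.const _))).add
    (((UniformBddLip.snd.mul .snd).mul (.const _)).mul (.const _))

lemma firstOrder_rescaled (hf : ContDiffAt ℝ 3 f p) {ρ : ℝ} (hρ : 0 ≤ ρ) :
    FirstOrderE3 ρ (rescaled f p) (fun q => q.1 • partialU f p + q.2 • partialV f p) := by
  intro i
  refine ⟨?_, _, (uniformBddLip_quadratic (fderiv ℝ (fderiv ℝ f) p (1, 0) (1, 0) i)
    (mixedDeriv f p i) (fderiv ℝ (fderiv ℝ f) p (0, 1) (0, 1) i)).add
    (UniformBddLip.param.mul (uniformBddLip_remainder hf hρ i)), ?_⟩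
  · simpa using (UniformBddLip.fst.mul (.const (partialU f p i))).add
      (UniformBddLip.snd.mul (.const (partialV f p i)))
  · filter_upwards [self_mem_nhdsWithin] with ε (hε : 0 < ε) q _
    rw [rescaled_eq hf hε.ne']
    simp [quadraticPart]
    ring

/-- The linear terms cancel, and subtracting the quadratic parts at (1, 0) and (0, 1) turns x² and
y² into x² - x and y² - y. -/
lemma firstOrder_rescaledDeviation (hf : ContDiffAt ℝ 3 f p) {ρ : ℝ} (hρ : 1 ≤ ρ) :
    FirstOrderE3 ρ (rescaledDeviation f p) (fun q => ((q.1 ^ 2 - q.1) / 2) •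
      fderiv ℝ (fderiv ℝ f) p (1, 0) (1, 0) + (q.1 * q.2) • mixedDeriv f p
        + ((q.2 ^ 2 - q.2) / 2) • fderiv ℝ (fderiv ℝ f) p (0, 1) (0, 1)) := by
  intro i
  have hr := uniformBddLip_remainder hf (zero_le_one.trans hρ) i
  refine ⟨?_, _, (hr.sub (UniformBddLip.fst.mul (hr.eval (norm_corners_le hρ).1))).sub
    (UniformBddLip.snd.mul (hr.eval (norm_corners_le hρ).2.1)), ?_⟩
  · have := ((uniformBddLip_quadratic (ρ := ρ) (fderiv ℝ (fderiv ℝ f) p (1, 0) (1, 0) i)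
      (mixedDeriv f p i) (fderiv ℝ (fderiv ℝ f) p (0, 1) (0, 1) i)).sub
      (UniformBddLip.fst.mul (.const (fderiv ℝ (fderiv ℝ f) p (1, 0) (1, 0) i / 2)))).sub
      (UniformBddLip.snd.mul (.const (fderiv ℝ (fderiv ℝ f) p (0, 1) (0, 1) i / 2)))
    convert this using 3
    simp
    ring
  · filter_upwards [self_mem_nhdsWithin] with ε (hε : 0 < ε) q _
    rw [rescaledDeviation, rescaled_eq hf hε.ne', rescaled_eq hf hε.ne' (1, 0),
      rescaled_eq hf hε.ne' (0, 1)]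
    simp [quadraticPart]
    field_simp
    ring

lemma jet_rescaled (hf : ContDiffAt ℝ 3 f p) (q : ℝ × ℝ) :
    JetE3 (fun ε => rescaled f p ε q) (q.1 • partialU f p + q.2 • partialV f p)
      (quadraticPart f p q) := by
  obtain ⟨K, hK⟩ := taylorRemainder_rescaled hf (norm_nonneg q)
  refine JetE3.of_isBigO (IsBigO.of_bound K ?_)
  filter_upwards [hK, self_mem_nhdsWithin] with ε h (hε : 0 < ε)
  rw [rescaled_eq hf hε.ne', add_assoc, add_sub_cancel_left, add_sub_cancel_left, norm_smul,
    mul_comm]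
  exact mul_le_mul_of_nonneg_right (h q le_rfl).1 (norm_nonneg _)

lemma jet_rescaledDeviation (hf : ContDiffAt ℝ 4 f p) :
    JetE3 (fun ε => rescaledDeviation f p ε (1, 1)) (mixedDeriv f p)
      ((1 / 2 : ℝ) • (fderiv ℝ (mixedDeriv f) p (1, 0) + fderiv ℝ (mixedDeriv f) p (0, 1))) := by
  refine JetE3.of_isBigO ?_
  have h := (isBigO_refl (fun ε : ℝ => (ε ^ 2)⁻¹) (𝓝[>] 0)).smul (mixedDifference_isBigO hf)
  refine h.congr' ?_ ?_
  · filter_upwards [self_mem_nhdsWithin] with ε (hε : 0 < ε)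
    have e1 : ε • ((1, 1) : ℝ × ℝ) = (ε, ε) := by simp
    have e2 : ε • ((1, 0) : ℝ × ℝ) = (ε, 0) := by simp
    have e3 : ε • ((0, 1) : ℝ × ℝ) = (0, ε) := by simp
    have e4 : (ε ^ 2)⁻¹ = ε⁻¹ * ε⁻¹ := by field_simp
    have e5 : ε⁻¹ * ε⁻¹ * ε ^ 2 = 1 := by field_simp
    have e6 : ε⁻¹ * ε⁻¹ * (ε ^ 3 / 2) = ε * (1 / 2) := by field_simp
    simp only [rescaledDeviation, rescaled, e1, e2, e3, e4, one_smul]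
    rw [smul_sub (ε⁻¹ * ε⁻¹) _ (ε ^ 2 • mixedDeriv f p + _), smul_add _ (ε ^ 2 • mixedDeriv f p),
      smul_smul, smul_smul, e5, e6]
    module
  · filter_upwards [self_mem_nhdsWithin] with ε (hε : 0 < ε)
    rw [smul_eq_mul]
    field_simp

lemma rescaled_zero (ε : ℝ) : rescaled f p ε (0, 0) = 0 := by
  simp [rescaled, Prod.mk_zero_zero]

lemma rescaledDeviation_corner {q : ℝ × ℝ} (hq : q ∈ threeCorners) (ε : ℝ) :
    rescaledDeviation f p ε q = 0 := by
  rcases hq with rfl | rfl | rfl <;> simp [rescaledDeviation, rescaled_zero]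

/-- The surface is flat to leading order, so the plane equation degenerates as ε → 0. Column
operations extract the factor ε and leave a nondegenerate limit. -/
lemma det3_rescaled {ε : ℝ} (hε : ε ≠ 0) (q : ℝ × ℝ) :
    det3 (rescaled f p ε q) (rescaled f p ε (1, 0)) (rescaled f p ε (0, 1)) =
      ε * det3 (rescaledDeviation f p ε q) (rescaled f p ε (1, 0)) (rescaled f p ε (0, 1)) := by
  rw [← det3_smul_left, rescaledDeviation, smul_inv_smul₀ hε]
  simp [det3_eq]
  ring

lemma circleForm_zero (b c : E3) : circleForm 0 b c = 0 := by simp [circleForm]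

lemma circleForm_left (b c : E3) : circleForm b b c = 0 := by
  rw [circleForm, gram2]; ring

lemma circleForm_right (b c : E3) : circleForm c b c = 0 := by
  rw [circleForm, gram2, real_inner_comm b c]; ring

lemma circleForm_corner {q : ℝ × ℝ} (hq : q ∈ threeCorners) (ε : ℝ) :
    circleForm (rescaled f p ε q) (rescaled f p ε (1, 0)) (rescaled f p ε (0, 1)) = 0 := by
  rcases hq with rfl | rfl | rfl
  · rw [rescaled_zero, circleForm_zero]
  · exact circleForm_left _ _
  · exact circleForm_right _ _

end Rescaled

/-! ### Both equations hold up to O(ε²) at the fourth corner. -/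

lemma Jet.isBigO {g : ℝ → ℝ} {g₀ g₁ : ℝ} (h : Jet g g₀ g₁) (h₀ : g₀ = 0) (h₁ : g₁ = 0) :
    g =O[𝓝[>] 0] (fun ε : ℝ => ε ^ 2) :=
  IsBigO.congr_left h fun ε => by rw [h₀, h₁]; ring

lemma det3_smul_mid (c : ℝ) (x y z : E3) : det3 x (c • y) z = c * det3 x y z := by
  simp [det3_eq]; ring

lemma det3_smul_right (c : ℝ) (x y z : E3) : det3 x y (c • z) = c * det3 x y z := by
  simp [det3_eq]; ring

section FourthCorner

variable {f : ℝ × ℝ → E3} {p : ℝ × ℝ}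

lemma det3_fourthCorner_isBigO (hf : ContDiffAt ℝ 4 f p) {a b : E3}
    (ha : a = partialU f p) (hb : b = partialV f p)
    (h0 : det3 (mixedDeriv f p) a b = 0)
    (h1 : det3 (fderiv ℝ (mixedDeriv f) p (1, 0) + fderiv ℝ (mixedDeriv f) p (0, 1)) a b
      + det3 (mixedDeriv f p) (fderiv ℝ (fderiv ℝ f) p (1, 0) (1, 0)) b
      + det3 (mixedDeriv f p) a (fderiv ℝ (fderiv ℝ f) p (0, 1) (0, 1)) = 0) :
    (fun ε => det3 (rescaledDeviation f p ε (1, 1)) (rescaled f p ε (1, 0))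
      (rescaled f p ε (0, 1))) =O[𝓝[>] 0] (fun ε : ℝ => ε ^ 2) := by
  subst ha hb
  have hf3 : ContDiffAt ℝ 3 f p := hf.of_le (by norm_num)
  have jb := jet_rescaled hf3 (1, 0)
  have jc := jet_rescaled hf3 (0, 1)
  simp only [quadraticPart, one_smul, zero_smul, add_zero, zero_add, one_pow, mul_zero, mul_one,
    zero_div, ne_eq, OfNat.ofNat_ne_zero, not_false_eq_true, zero_pow] at jb jc
  refine ((jet_rescaledDeviation hf).det3 jb jc).isBigO h0 ?_
  rw [det3_smul_left, det3_smul_mid, det3_smul_right]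
  linear_combination 1 / 2 * h1

/-- At order 0 the four points form a rectangle, which is cyclic. The order-ε coefficient is EG
times the derivative of ⟨f_u, f_v⟩ along (1, 1). -/
lemma circleForm_fourthCorner_isBigO (hf : ContDiffAt ℝ 3 f p) {a b m P S : E3}
    (ha : a = partialU f p) (hb : b = partialV f p) (hm : m = mixedDeriv f p)
    (hP : P = fderiv ℝ (fderiv ℝ f) p (1, 0) (1, 0))
    (hS : S = fderiv ℝ (fderiv ℝ f) p (0, 1) (0, 1))
    (h0 : inner ℝ a b = (0 : ℝ)) (h1 : inner ℝ P b + inner ℝ a m = (0 : ℝ))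
    (h2 : inner ℝ m b + inner ℝ a S = (0 : ℝ)) :
    (fun ε => circleForm (rescaled f p ε (1, 1)) (rescaled f p ε (1, 0))
      (rescaled f p ε (0, 1))) =O[𝓝[>] 0] (fun ε : ℝ => ε ^ 2) := by
  have jx := jet_rescaled hf (1, 1)
  have jb := jet_rescaled hf (1, 0)
  have jc := jet_rescaled hf (0, 1)
  simp only [quadraticPart, one_smul, zero_smul, add_zero, zero_add, one_pow, mul_zero, mul_one,
    zero_div, ne_eq, OfNat.ofNat_ne_zero, not_false_eq_true, zero_pow] at jx jb jc
  rw [← ha, ← hb, ← hm, ← hP, ← hS] at jx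
  rw [← ha, ← hP] at jb
  rw [← hb, ← hS] at jc
  have h0' : inner ℝ b a = (0 : ℝ) := by rw [real_inner_comm, h0]
  have jxx := jx.inner jx
  have jxb := jx.inner jb
  have jxc := jx.inner jc
  have jbb := jb.inner jb
  have jcc := jc.inner jc
  have jbc := jb.inner jc
  have jg := (jbb.mul jcc).sub (jbc.mul jbc)
  have j := ((jg.mul jxx).sub ((jbb.mul jcc).mul (jxb.add jxc))).add
    (jbc.mul ((jbb.mul jxc).add (jcc.mul jxb)))
  refine (j.isBigO ?_ ?_).congr_left fun ε => by rw [circleForm, gram2, pow_two]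
  · simp only [inner_add_left, inner_add_right, h0, h0']
    ring
  · simp only [inner_add_left, inner_add_right, real_inner_smul_left, real_inner_smul_right, h0,
      h0', real_inner_comm a P, real_inner_comm b P, real_inner_comm a S, real_inner_comm b S,
      real_inner_comm a m, real_inner_comm b m] at h1 h2 ⊢
    linear_combination inner ℝ a a * inner ℝ b b * (h1 + h2)

end FourthCorner

/-! ### Scaling, size of the circle, and bilipschitz control. -/

lemma circleForm_smul (c : ℝ) (x y z : E3) :
    circleForm (c • x) (c • y) (c • z) = c ^ 6 * circleForm x y z := by
  simp only [circleForm, gram2, real_inner_smul_left, real_inner_smul_right]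
  ring

lemma gram2_smul (c : ℝ) (y z : E3) : gram2 (c • y) (c • z) = c ^ 4 * gram2 y z := by
  simp only [gram2, real_inner_smul_left, real_inner_smul_right]
  ring

lemma det3_smul_smul_smul (c : ℝ) (x y z : E3) :
    det3 (c • x) (c • y) (c • z) = c ^ 3 * det3 x y z := by
  rw [det3_smul_left, det3_smul_mid, det3_smul_right]
  ring

/-- The equation has the form gram · |x|² = (linear in x), so Cauchy–Schwarz bounds |x|. -/
lemma gram2_mul_norm_le {x b c : E3} (h : circleForm x b c = 0) :
    gram2 b c * ‖x‖ ≤ 2 * (‖b‖ ^ 2 * ‖c‖ ^ 2 * (‖b‖ + ‖c‖)) := by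
  rcases eq_or_ne x 0 with rfl | hx
  · rw [norm_zero, mul_zero]; positivity
  refine le_of_mul_le_mul_right ?_ (norm_pos_iff.2 hx)
  have e : gram2 b c * ‖x‖ * ‖x‖ = ‖b‖ ^ 2 * ‖c‖ ^ 2 * (inner ℝ x b + inner ℝ x c)
      - inner ℝ b c * (‖b‖ ^ 2 * inner ℝ x c + ‖c‖ ^ 2 * inner ℝ x b) := by
    simp only [circleForm, real_inner_self_eq_norm_sq] at h
    linear_combination h
  have h1 : (inner ℝ x b : ℝ) ≤ ‖x‖ * ‖b‖ := real_inner_le_norm _ _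
  have h2 : (inner ℝ x c : ℝ) ≤ ‖x‖ * ‖c‖ := real_inner_le_norm _ _
  have h3 : |inner ℝ b c * (‖b‖ ^ 2 * inner ℝ x c + ‖c‖ ^ 2 * inner ℝ x b)| ≤
      (‖b‖ * ‖c‖) * (‖b‖ ^ 2 * (‖x‖ * ‖c‖) + ‖c‖ ^ 2 * (‖x‖ * ‖b‖)) := by
    rw [abs_mul]
    refine mul_le_mul (abs_real_inner_le_norm _ _) ?_ (abs_nonneg _) (by positivity)
    refine (abs_add_le _ _).trans (add_le_add ?_ ?_)
    · rw [abs_mul, abs_of_nonneg (sq_nonneg _)]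
      exact mul_le_mul_of_nonneg_left (abs_real_inner_le_norm _ _) (sq_nonneg _)
    · rw [abs_mul, abs_of_nonneg (sq_nonneg _)]
      exact mul_le_mul_of_nonneg_left (abs_real_inner_le_norm _ _) (sq_nonneg _)
  have h4 := neg_abs_le (inner ℝ b c * (‖b‖ ^ 2 * inner ℝ x c + ‖c‖ ^ 2 * inner ℝ x b))
  have h5 : ‖b‖ ^ 2 * ‖c‖ ^ 2 * (inner ℝ x b + inner ℝ x c) ≤
      ‖b‖ ^ 2 * ‖c‖ ^ 2 * (‖x‖ * ‖b‖ + ‖x‖ * ‖c‖) :=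
    mul_le_mul_of_nonneg_left (add_le_add h1 h2) (by positivity)
  rw [e]
  linarith

/-- The injective differential expands by at least 1/k; approximating f within 1/(2k) loses only
half of that. -/
lemma exists_bilipschitz_nhds {f : ℝ × ℝ → E3} {p : ℝ × ℝ} (hf : ContDiffAt ℝ 1 f p)
    (hreg : LinearIndependent ℝ ![partialU f p, partialV f p]) :
    ∃ s ∈ 𝓝 p, ∃ c C : ℝ, 0 < c ∧ 0 < C ∧ ∀ x ∈ s, ∀ y ∈ s,
      ‖x - y‖ ≤ c * ‖f x - f y‖ ∧ ‖f x - f y‖ ≤ C * ‖x - y‖ := by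
  have hker : LinearMap.ker (fderiv ℝ f p : (ℝ × ℝ) →ₗ[ℝ] E3) = ⊥ := by
    rw [LinearMap.ker_eq_bot']
    intro w hw
    have hw' : fderiv ℝ f p w = 0 := hw
    rw [fderiv_eq_partial] at hw'
    have := LinearIndependent.pair_iff.1 hreg _ _ hw'
    exact Prod.ext this.1 this.2
  obtain ⟨k, hk, hk'⟩ := LinearMap.exists_antilipschitzWith _ hker
  have hk0 : (0 : ℝ) < k := hk
  have hd : (0 : NNReal) < 1 / (2 * k) := by positivity
  obtain ⟨s, hs, H⟩ := (hf.hasStrictFDerivAt one_ne_zero).approximates_deriv_on_nhds (Or.inr hd)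
  refine ⟨s, hs, 2 * k, ‖fderiv ℝ f p‖ + 1 / (2 * k), by positivity, by positivity,
    fun x hx y hy => ?_⟩
  have h1 := H x hx y hy
  have h2 : ‖x - y‖ ≤ k * ‖fderiv ℝ f p (x - y)‖ := by
    have := hk'.le_mul_dist x y
    rwa [dist_eq_norm, dist_eq_norm, ← map_sub] at this
  have h3 := (fderiv ℝ f p).le_opNorm (x - y)
  have h4 := norm_le_norm_add_norm_sub' (f x - f y) (fderiv ℝ f p (x - y))
  have h5 := norm_le_norm_add_norm_sub (f x - f y) (fderiv ℝ f p (x - y))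
  push_cast at h1
  constructor
  · have h6 : (k : ℝ) * (1 / (2 * k) * ‖x - y‖) = ‖x - y‖ / 2 := by field_simp
    have h7 := mul_le_mul_of_nonneg_left (h5.trans (add_le_add_right h1 _)) hk0.le
    rw [mul_add, h6] at h7
    linarith
  · rw [add_mul]; linarith

/-! ### Parameters of the circle points on the magnified surface. -/

section CircleOnSurface

variable {f : ℝ × ℝ → E3} {p : ℝ × ℝ}

lemma mem_circleThrough_rescaled {ε : ℝ} (hε : ε ≠ 0)
    (hg : gram2 (rescaled f p ε (1, 0)) (rescaled f p ε (0, 1)) ≠ 0) (q : ℝ × ℝ) :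
    f (p + ε • q) ∈ circleThrough (f p) (f (p + ε • (1, 0))) (f (p + ε • (0, 1))) ↔
      det3 (rescaledDeviation f p ε q) (rescaled f p ε (1, 0)) (rescaled f p ε (0, 1)) = 0 ∧
      circleForm (rescaled f p ε q) (rescaled f p ε (1, 0)) (rescaled f p ε (0, 1)) = 0 := by
  have h : ∀ q, f (p + ε • q) - f p = ε • rescaled f p ε q := fun q =>
    (smul_inv_smul₀ hε _).symm
  rw [mem_circleThrough_iff]
  · rw [h, h, h, det3_smul_smul_smul, circleForm_smul, det3_rescaled hε]
    simp [hε]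
  · rw [h, h, gram2_smul]
    exact mul_ne_zero (pow_ne_zero _ hε) hg

/-- For small `ε`, the parameters near `0` of the points of the magnified surface which lie on the
circle are the three given ones and one more, which is `O(ε²)`-close to `(1, 1)`. -/
lemma IsCurvatureLineNet.eventually_four_parameters {Ω : Set (ℝ × ℝ)}
    (hf : IsCurvatureLineNet f Ω) (hp : p ∈ Ω) (hnu : ¬ IsUmbilic f p) {ρ : ℝ} (hρ : 2 ≤ ρ) :
    ∃ K : ℝ, ∀ᶠ ε in 𝓝[>] (0 : ℝ), ∃ M : ℝ × ℝ, ‖M - (1, 1)‖ ≤ K * ε ^ 2 ∧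
      ‖M - (1, 1)‖ ≤ 1 / 4 ∧ ∀ q, (q ∈ threeCorners ∨ q = M →
        det3 (rescaledDeviation f p ε q) (rescaled f p ε (1, 0)) (rescaled f p ε (0, 1)) = 0 ∧
        circleForm (rescaled f p ε q) (rescaled f p ε (1, 0)) (rescaled f p ε (0, 1)) = 0) ∧
      (‖q‖ ≤ ρ →
        det3 (rescaledDeviation f p ε q) (rescaled f p ε (1, 0)) (rescaled f p ε (0, 1)) = 0 →
        circleForm (rescaled f p ε q) (rescaled f p ε (1, 0)) (rescaled f p ε (0, 1)) = 0 →
        q ∈ threeCorners ∨ q = M) := by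
  obtain ⟨i0, d0, i1, i2, d1, hne⟩ := hf.jet hp hnu
  obtain ⟨hE, hG⟩ := hf.inner_self_pos hp
  have hf4 := hf.contDiffAt hp 4
  have hf3 := hf.contDiffAt hp 3
  have oF := det3_fourthCorner_isBigO hf4 rfl rfl d0 d1
  have oG := circleForm_fourthCorner_isBigO hf3 rfl rfl rfl rfl rfl i0 i1 i2
  have hρ1 : 1 ≤ ρ := by linarith
  have fX := firstOrder_rescaled hf3 (zero_le_one.trans hρ1)
  have fB := fX.eval (norm_corners_le hρ1).1
  have fC := fX.eval (norm_corners_le hρ1).2.1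
  have fF := (firstOrder_rescaledDeviation hf3 hρ1).det3 fB fC
  have fG := fX.circleForm fB fC
  set a := partialU f p
  set b := partialV f p
  set P := fderiv ℝ (fderiv ℝ f) p (1, 0) (1, 0)
  set S := fderiv ℝ (fderiv ℝ f) p (0, 1) (0, 1)
  set m := mixedDeriv f p
  set E : ℝ := inner ℝ a a
  set G : ℝ := inner ℝ b b
  set L := det3 P a b
  set N := det3 S a b
  set F' : ℝ → ℝ × ℝ → ℝ := fun ε q =>
    det3 (rescaledDeviation f p ε q) (rescaled f p ε (1, 0)) (rescaled f p ε (0, 1)) with hF'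
  set G' : ℝ → ℝ × ℝ → ℝ := fun ε q =>
    circleForm (rescaled f p ε q) (rescaled f p ε (1, 0)) (rescaled f p ε (0, 1))
  obtain ⟨i, hi⟩ : ∃ i, (L * G - N * E) * i = 1 := ⟨_, mul_inv_cancel₀ (sub_ne_zero.2 hne)⟩
  obtain ⟨j, hj⟩ : ∃ j, (E * G) * j = 1 := ⟨_, mul_inv_cancel₀ (mul_pos hE hG).ne'⟩
  have eF : ∀ q : ℝ × ℝ, det3 (((q.1 ^ 2 - q.1) / 2) • P + (q.1 * q.2) • m
      + ((q.2 ^ 2 - q.2) / 2) • S) ((1 : ℝ) • a + (0 : ℝ) • b) ((0 : ℝ) • a + (1 : ℝ) • b) =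
      ((q.1 ^ 2 - q.1) * L + (q.2 ^ 2 - q.2) * N) / 2 := by
    intro q
    simp only [one_smul, zero_smul, add_zero, zero_add, det3_add_left, det3_smul_left, d0]
    ring
  have i0' : inner ℝ b a = (0 : ℝ) := by rw [real_inner_comm, i0]
  have eG : ∀ q : ℝ × ℝ, circleForm (q.1 • a + q.2 • b) ((1 : ℝ) • a + (0 : ℝ) • b)
      ((0 : ℝ) • a + (1 : ℝ) • b) =
      E * G * ((q.1 ^ 2 - q.1) * E + (q.2 ^ 2 - q.2) * G) := by
    intro q
    simp only [one_smul, zero_smul, add_zero, zero_add, circleForm_add_smul]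
    simp only [gram2, inner_add_left, inner_add_right, real_inner_smul_left,
      real_inner_smul_right, i0, i0', E, G]
    ring
  -- Cramer's rule for the limit system: these combinations of the two equations isolate x² - x here
  -- and y² - y below.
  have hP₁ : FirstOrder ρ (fun ε q => 2 * G * i * F' ε q
      - N * i * j * G' ε q) (fun q => q.1 ^ 2 - q.1) := by
    refine (((FirstOrder.const _).mul fF).sub ((FirstOrder.const _).mul fG)).congr ?_
      (Eventually.of_forall fun _ _ => rfl)
    intro q
    rw [eF, eG]
    linear_combination (q.1 ^ 2 - q.1) * hi
      - N * i * ((q.1 ^ 2 - q.1) * E + (q.2 ^ 2 - q.2) * G) * hj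
  have hP₂ : FirstOrder ρ (fun ε q => L * i * j * G' ε q
      - 2 * E * i * F' ε q) (fun q => q.2 ^ 2 - q.2) := by
    refine (((FirstOrder.const _).mul fG).sub ((FirstOrder.const _).mul fF)).congr ?_
      (Eventually.of_forall fun _ _ => rfl)
    intro q
    rw [eF, eG]
    linear_combination (q.2 ^ 2 - q.2) * hi
      + L * i * ((q.1 ^ 2 - q.1) * E + (q.2 ^ 2 - q.2) * G) * hj
  have hcorner : ∀ ε, ∀ q ∈ threeCorners, F' ε q = 0 ∧ G' ε q = 0 := fun ε q hq =>
    ⟨by rw [hF']; simp only [rescaledDeviation_corner hq]; simp [det3], circleForm_corner hq ε⟩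
  obtain ⟨K, hK⟩ := eventually_four_zeros hρ hP₁ hP₂
    (Eventually.of_forall fun ε q hq => by
      rw [(hcorner ε q hq).1, (hcorner ε q hq).2]; simp)
    ((oF.const_mul_left _).sub (oG.const_mul_left _))
    ((oG.const_mul_left _).sub (oF.const_mul_left _))
  refine ⟨K, ?_⟩
  filter_upwards [hK] with ε ⟨M, hM, hM4, ⟨hM1, hM2⟩, hu⟩
  refine ⟨M, hM, hM4, fun q => ⟨?_, fun hq hFq hGq => ?_⟩⟩
  · rintro (hq | rfl)
    · exact hcorner ε q hq
    · change F' ε q = 0 ∧ G' ε q = 0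
      -- Inverts the Cramer combinations, so that their vanishing gives back the plane and sphere
      -- equations.
      have z1 : F' ε q = (L * (2 * G * i * F' ε q
          - N * i * j * G' ε q) + N * (L * i * j * G' ε q
          - 2 * E * i * F' ε q)) / 2 := by
        linear_combination (-F' ε q) * hi
      have z2 : G' ε q = E * G * (E * (2 * G * i * F' ε q
          - N * i * j * G' ε q) + G * (L * i * j * G' ε q
          - 2 * E * i * F' ε q)) := by
        linear_combination (-(G' ε q * (i * (L * G - N * E)))) * hj - G' ε q * hi
      rw [hM1, hM2] at z1 z2
      exact ⟨by simpa using z1, by simpa using z2⟩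
  · have hFq' : F' ε q = 0 := hFq
    have hGq' : G' ε q = 0 := hGq
    exact hu q hq (by rw [hFq', hGq']; simp) (by rw [hFq', hGq']; simp)

/-- The magnified circles are nondegenerate and of bounded size. -/
lemma IsCurvatureLineNet.eventually_circle_bounded {Ω : Set (ℝ × ℝ)}
    (hf : IsCurvatureLineNet f Ω) (hp : p ∈ Ω) : ∃ R : ℝ, 0 ≤ R ∧ ∀ᶠ ε in 𝓝[>] (0 : ℝ),
      gram2 (rescaled f p ε (1, 0)) (rescaled f p ε (0, 1)) ≠ 0 ∧
      ∀ x, circleForm x (rescaled f p ε (1, 0)) (rescaled f p ε (0, 1)) = 0 → ‖x‖ ≤ R := by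
  have fX := firstOrder_rescaled (hf.contDiffAt hp 3) zero_le_one
  have fB := fX.eval (norm_corners_le le_rfl).1
  have fC := fX.eval (norm_corners_le le_rfl).2.1
  have n0 : ‖(0 : ℝ × ℝ)‖ ≤ 1 := by simp
  have tb := (((fB.inner fB).tendsto n0).sqrt)
  have tc := (((fC.inner fC).tendsto n0).sqrt)
  have tg := (fB.gram2 fC).tendsto n0
  simp only [one_smul, zero_smul, add_zero, zero_add, ← norm_eq_sqrt_real_inner] at tb tc tg
  have hg : 0 < gram2 (partialU f p) (partialV f p) := by
    refine lt_of_le_of_ne ?_ (hf.gram2_ne_zero hp).symm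
    rw [gram2_eq_inner_cross3]
    exact real_inner_self_nonneg
  have tq := ((((tb.pow 2).mul (tc.pow 2)).mul (tb.add tc)).const_mul 2).div tg hg.ne'
  refine ⟨2 * (‖partialU f p‖ ^ 2 * ‖partialV f p‖ ^ 2 * (‖partialU f p‖ + ‖partialV f p‖)) /
    gram2 (partialU f p) (partialV f p) + 1, by positivity, ?_⟩
  filter_upwards [tg.eventually_const_lt hg, tq.eventually_lt_const (lt_add_one _)] with ε h1 h2
  refine ⟨h1.ne', fun x hx => le_trans ?_ h2.le⟩
  rw [Pi.div_apply, le_div_iff₀ h1, mul_comm]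
  exact gram2_mul_norm_le hx

end CircleOnSurface

/-! ### Return from the magnified picture to the surface. -/

lemma square_subset_of_closedBall_subset {u v ε : ℝ} {U : Set (ℝ × ℝ)}
    (h : Metric.closedBall (u, v) ε ⊆ U) :
    Set.Icc u (u + ε) ×ˢ Set.Icc v (v + ε) ⊆ U := by
  rintro ⟨x, y⟩ ⟨hx, hy⟩
  refine h (mem_closedBall_iff_norm.2 (norm_prod_le_of_abs ?_ ?_))
  · exact abs_le.2 ⟨by simp; linarith [hx.1, hx.2], by simp; linarith [hx.2]⟩
  · exact abs_le.2 ⟨by simp; linarith [hy.1, hy.2], by simp; linarith [hy.2]⟩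

theorem mainTheorem7 (f : ℝ × ℝ → E3) (Ω : Set (ℝ × ℝ)) (hf : IsCurvatureLineNet f Ω)
    (u₀ v₀ : ℝ) (hA : (u₀, v₀) ∈ Ω) (hnu : ¬ IsUmbilic f (u₀, v₀)) :
    ∃ U₀ ∈ 𝓝 (u₀, v₀), U₀ ⊆ Ω ∧ ∃ K : ℝ, ∀ U ∈ 𝓝 (u₀, v₀), U ⊆ U₀ →
      ∃ ε₀ > 0, ∀ ε : ℝ, 0 < ε → ε < ε₀ →
        Set.Icc u₀ (u₀ + ε) ×ˢ Set.Icc v₀ (v₀ + ε) ⊆ U ∧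
        AffineIndependent ℝ ![f (u₀, v₀), f (u₀ + ε, v₀), f (u₀, v₀ + ε)] ∧
        ∃ M : E3, M ∉ ({f (u₀, v₀), f (u₀ + ε, v₀), f (u₀, v₀ + ε)} : Set E3) ∧
          circleThrough (f (u₀, v₀)) (f (u₀ + ε, v₀)) (f (u₀, v₀ + ε)) ∩ f '' U =
            {f (u₀, v₀), f (u₀ + ε, v₀), f (u₀, v₀ + ε), M} ∧
          dist (f (u₀ + ε, v₀ + ε)) M ≤ K * ε ^ 3 := by
  obtain ⟨s, hs, c, C, hc, hC, hbl⟩ :=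
    exists_bilipschitz_nhds (hf.contDiffAt hA 1) (hf.regular _ hA)
  obtain ⟨R, hR, hcirc⟩ := hf.eventually_circle_bounded hA
  -- The radius 2 contains the corners and the fourth parameter; cR contains every parameter whose
  -- magnified image lies on the circle.
  obtain ⟨K, hK⟩ := hf.eventually_four_parameters hA hnu (le_max_left 2 (c * R))
  refine ⟨s ∩ Ω, inter_mem hs (hf.isOpen.mem_nhds hA), Set.inter_subset_right, C * K,
    fun U hU hUs => ?_⟩
  obtain ⟨r, hr, hrU⟩ := Metric.nhds_basis_closedBall.mem_iff.1 hU
  -- Only this smallness depends on U; the constant CK does not. It places p + εq in U for ‖q‖ ≤ 2.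
  have hsmall : ∀ᶠ ε in 𝓝[>] (0 : ℝ), ε < r / 2 :=
    tendsto_param_zero.eventually_lt_const (half_pos hr)
  suffices H : ∀ᶠ ε in 𝓝[>] (0 : ℝ), Set.Icc u₀ (u₀ + ε) ×ˢ Set.Icc v₀ (v₀ + ε) ⊆ U ∧
        AffineIndependent ℝ ![f (u₀, v₀), f (u₀ + ε, v₀), f (u₀, v₀ + ε)] ∧
        ∃ M : E3, M ∉ ({f (u₀, v₀), f (u₀ + ε, v₀), f (u₀, v₀ + ε)} : Set E3) ∧
          circleThrough (f (u₀, v₀)) (f (u₀ + ε, v₀)) (f (u₀, v₀ + ε)) ∩ f '' U =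
            {f (u₀, v₀), f (u₀ + ε, v₀), f (u₀, v₀ + ε), M} ∧
          dist (f (u₀ + ε, v₀ + ε)) M ≤ C * K * ε ^ 3 by
    obtain ⟨ε₀, h0, h⟩ := mem_nhdsGT_iff_exists_Ioo_subset.1 H
    exact ⟨ε₀, h0, fun ε h1 h2 => h ⟨h1, h2⟩⟩
  filter_upwards [hcirc, hK, hsmall, self_mem_nhdsWithin]
    with ε ⟨hg, hbound⟩ ⟨m, hm, hm4, hiff⟩ hεr (hε : 0 < ε)
  set p : ℝ × ℝ := (u₀, v₀) with hp
  have hB : ((u₀ + ε, v₀) : ℝ × ℝ) = p + ε • (1, 0) := by simp [hp]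
  have hC' : ((u₀, v₀ + ε) : ℝ × ℝ) = p + ε • (0, 1) := by simp [hp]
  have hD : ((u₀ + ε, v₀ + ε) : ℝ × ℝ) = p + ε • (1, 1) := by simp [hp]
  have hA' : p = p + ε • (0, 0) := by simp [Prod.mk_zero_zero]
  have hmemU : ∀ q : ℝ × ℝ, ‖q‖ ≤ 2 → p + ε • q ∈ U := by
    intro q hq
    refine hrU (mem_closedBall_iff_norm.2 ?_)
    rw [add_sub_cancel_left, norm_smul, Real.norm_of_nonneg hε.le]
    nlinarith
  have hn1 : ‖((1, 1) : ℝ × ℝ)‖ = 1 := by simp [Prod.norm_def]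
  have hm2 : ‖m‖ ≤ 2 := by
    have := norm_le_norm_add_norm_sub' m (1, 1)
    linarith
  have hc2 : ∀ q ∈ threeCorners, ‖q‖ ≤ 2 := by
    intro q hq
    have : ‖q‖ ≤ 1 := by rcases hq with rfl | rfl | rfl <;> simp [Prod.norm_def]
    linarith
  have hmc : m ∉ threeCorners := by
    intro h
    have h1 := abs_le.1 ((norm_fst_le (m - (1, 1))).trans hm4)
    have h2 := abs_le.1 ((norm_snd_le (m - (1, 1))).trans hm4)
    simp only [Prod.fst_sub, Prod.snd_sub] at h1 h2
    rcases h with rfl | rfl | rfl <;> linarith [h1.1, h2.1]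
  have hinj : ∀ q q' : ℝ × ℝ, ‖q‖ ≤ 2 → ‖q'‖ ≤ 2 → f (p + ε • q) = f (p + ε • q') → q = q' := by
    intro q q' hq hq' h
    have h1 := (hbl _ (hUs (hmemU q hq)).1 _ (hUs (hmemU q' hq')).1).1
    rw [h, sub_self, norm_zero, mul_zero] at h1
    have h2 := sub_eq_zero.1 (norm_le_zero_iff.1 h1)
    exact smul_right_injective _ hε.ne' (add_left_cancel h2)
  have hcorner : ({f p, f (p + ε • (1, 0)), f (p + ε • (0, 1))} : Set E3) =
      (fun q => f (p + ε • q)) '' threeCorners := by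
    rw [threeCorners, Set.image_insert_eq, Set.image_insert_eq, Set.image_singleton, ← hA']
  rw [hB, hC', hD]
  refine ⟨square_subset_of_closedBall_subset
    ((Metric.closedBall_subset_closedBall (by linarith)).trans hrU), ?_,
    f (p + ε • m), ?_, ?_, ?_⟩
  · refine affineIndependent_of_gram2_ne_zero ?_
    rw [rescaled, rescaled, gram2_smul] at hg
    exact right_ne_zero_of_mul hg
  · rw [hcorner]
    rintro ⟨q, hq, h⟩
    exact hmc (hinj q m (hc2 q hq) hm2 h ▸ hq)
  · have hset : ({f p, f (p + ε • (1, 0)), f (p + ε • (0, 1)), f (p + ε • m)} : Set E3) =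
        (fun q => f (p + ε • q)) '' (threeCorners ∪ {m}) := by
      rw [Set.image_union, ← hcorner, Set.image_singleton]
      ext x
      simp only [Set.mem_insert_iff, Set.mem_singleton_iff, Set.mem_union]
      tauto
    rw [hset]
    ext X
    constructor
    · rintro ⟨hX, x, hxU, rfl⟩
      obtain ⟨q, rfl⟩ : ∃ q : ℝ × ℝ, x = p + ε • q := ⟨ε⁻¹ • (x - p), by
        rw [smul_inv_smul₀ hε.ne', add_sub_cancel]⟩
      obtain ⟨h1, h2⟩ := (mem_circleThrough_rescaled hε.ne' hg q).1 hX
      refine ⟨q, (hiff q).2 ((?_ : ‖q‖ ≤ c * R).trans (le_max_right _ _)) h1 h2, rfl⟩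
      -- ε‖q‖ ≤ c‖f(p + εq) - f(p)‖ ≤ cεR, whatever the size of U.
      have h3 := (hbl _ (hUs hxU).1 p (hUs (mem_of_mem_nhds hU)).1).1
      have h4 := hbound _ h2
      rw [rescaled, norm_smul, norm_inv, Real.norm_of_nonneg hε.le, inv_mul_le_iff₀ hε] at h4
      rw [add_sub_cancel_left, norm_smul, Real.norm_of_nonneg hε.le] at h3
      refine le_of_mul_le_mul_left ?_ hε
      have := mul_le_mul_of_nonneg_left h4 hc.le
      linarith
    · rintro ⟨q, hq, rfl⟩
      refine ⟨(mem_circleThrough_rescaled hε.ne' hg q).2 ((hiff q).1 hq), p + ε • q,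
        hmemU q ?_, rfl⟩
      rcases hq with hq | rfl
      · exact hc2 q hq
      · exact hm2
  -- The distance from D to M is at most C times ε‖m - (1, 1)‖, which supplies the third power of ε.
  · have h1 := (hbl _ (hUs (hmemU (1, 1) (by rw [hn1]; norm_num))).1 _ (hUs (hmemU m hm2)).1).2
    rw [dist_eq_norm]
    rw [add_sub_add_left_eq_sub, ← smul_sub, norm_smul, Real.norm_of_nonneg hε.le,
      norm_sub_rev (1, 1) m] at h1
    refine h1.trans ?_
    calc C * (ε * ‖m - (1, 1)‖) ≤ C * (ε * (K * ε ^ 2)) := by gcongr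
      _ = C * K * ε ^ 3 := by ring
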